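/- **Setting.** Let $[n]=\{1,\dots,n\}$, $[n]^*=\{1^*,\dots,n^*\}$, $E_{\pm n}=[n]\cup[n]^*$, with the involution $i\mapsto i^*$, $i^{*}\mapsto i$. A set $S\subseteq E_{\pm n}$ is *admissible* if $S\cap S^*=\emptyset$. A linear ordering $<$ of $E_{\pm n}$ is *admissible* if $x<y$ implies $y^*<x^*$; it induces a partial ordering on the $k$-subsets: $\{a_1<\dots<a_k\}\le\{b_1<\dots<b_k\}$ iff $a_j\le b_j$ for all $j$. A *symplectic matroid* on $E_{\pm n}$ is given by its collection of *bases*: a non-empty family $\mathcal B$ of admissible sets of equal cardinality such that, for every admissible ordering, $\mathcal B$ has a unique maximal element. Its *circuits* are the minimal admissible sets not contained in any member of $\mathcal B$. For a family $\mathcal C$ of subsets of $E_{\pm n}$, let $\mathcal B(\mathcal C)$ be the family of maximal admissible sets containing no member of $\mathcal C$, and say that a set $P$ *spans* $x$ if $J\setminus P=\{x\}$ for some $J\in\mathcal C$. The circuit axioms are: * (SC1) $\emptyset\notin\mathcal C$. * (SC2) If $C_1,C_2\in\mathcal C$ and $C_1\subseteq C_2$, then $C_1=C_2$. * (SC3)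 If $C_1\ne C_2$ are in $\mathcal C$, $x\in C_1\cap C_2$ and $C_1\cup C_2$ is admissible, then some $C\in\mathcal C$ satisfies $C\subseteq(C_1\cup C_2)\setminus\{x\}$. * (SC4) If $P$ is admissible, $B\in\mathcal B(\mathcal C)$ and $|P|<|B|$, then $P$ does not span every element of $E_{\pm n}\setminus(P\cup P^*)$. Let $G$ be a finite undirected multigraph (loops and parallel edges allowed) with $n$ edges $e_1,\dots,e_n$. For admissible $S$ let $G(S)=\{e_i: i\in S\text{ or }i^*\in S\}$, and call $e_i$ negative in $S$ if $i^*\in S$. A *signing* $\sigma$ of $G$ gives each edge a sign; a cycle is *unbalanced* if it has an odd number of negative edges. The *signed-graphic matroid* $M(G,\sigma)$ has as ground set the signed edges ($i$ if $e_i$ is positive, $i^*$ if $e_i$ is negative); a set is independent iff every connected component of it is a tree or a unicyclic graph whose unique cycle is unbalanced. Its circuits are its minimal dependent sets. **Theorem.** Let $G$ be a finite undirected multigraph with $n$ edges. Let $\mathcal C(G)$ be the union, over all $2^n$ signings $\sigma$ of $G$, of the families of circuits of $M(G,\sigma)$, regarded as subsets of $E_{\pm n}$. Then $\mathcal C(G)$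 satisfies (SC1)–(SC4), and it is the collection of circuits of a symplectic matroid. Likewise, let $\mathcal C'(G)$ be the family of those admissible sets that are minimal under inclusion among the admissible $S$ with an even number of negative edges such that $G(S)$ is either a single cycle, or a union of one or more cycles each having an odd number of negative edges. Then $\mathcal C'(G)$ satisfies (SC1)–(SC4), and it is the collection of circuits of a symplectic matroid. -/

import Mathlib

/-- The ground set `E_{±n} = [n] ∪ [n]*`. The element `⟨i, false⟩` is `i`, and `⟨i, true⟩` is `i*`;
indices run over `Fin n`. -/
structure SignedElt (n : ℕ) where
  idx : Fin n
  starred : Bool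
deriving DecidableEq, Fintype

namespace SignedElt

/-- The involution `i ↦ i*`, `i* ↦ i`. -/
def star {n : ℕ} (x : SignedElt n) : SignedElt n := ⟨x.idx, !x.starred⟩

end SignedElt

namespace SymplecticMatroid

/-- `S* = {x* : x ∈ S}`. -/
def starSet {n : ℕ} (S : Finset (SignedElt n)) : Finset (SignedElt n) := S.image SignedElt.star

/-- `S` is admissible if `S ∩ S* = ∅`. -/
def Admissible {n : ℕ} (S : Finset (SignedElt n)) : Prop := S ∩ starSet S = ∅

/-- A linear ordering of `E_{±n}` is admissible if `x < y` implies `y* < x*`. -/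
def AdmissibleOrder {n : ℕ} (L : LinearOrder (SignedElt n)) : Prop :=
  ∀ x y : SignedElt n, L.lt x y → L.lt y.star x.star

/-- The ordering induced on finite sets of the same size by a linear ordering of `E_{±n}`:
if `A = {a₁ < ⋯ < a_k}` and `B = {b₁ < ⋯ < b_k}`, then `A ≤ B` means `a_j ≤ b_j` for all `j`. -/
def inducedLE {n : ℕ} (L : LinearOrder (SignedElt n)) (A B : Finset (SignedElt n)) : Prop :=
  List.Forall₂ (fun a b => L.le a b) (A.sort (fun a b => L.le a b)) (B.sort (fun a b => L.le a b))

/-- `𝓑` is the collection of bases of a symplectic matroid on `E_{±n}`: a non-empty family of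
equi-numerous admissible sets which, for every admissible ordering, has a unique maximal element
for the induced ordering. -/
structure IsBases {n : ℕ} (𝓑 : Set (Finset (SignedElt n))) : Prop where
  nonempty : 𝓑.Nonempty
  admissible : ∀ B ∈ 𝓑, Admissible B
  card_eq : ∀ A ∈ 𝓑, ∀ B ∈ 𝓑, A.card = B.card
  existsUnique_maximal : ∀ L : LinearOrder (SignedElt n), AdmissibleOrder L →
    ∃! B, B ∈ 𝓑 ∧ ∀ A ∈ 𝓑, inducedLE L B A → A = B

/-- The circuits of the symplectic matroid with bases `𝓑`: the minimal admissible sets that are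
not contained in any member of `𝓑`. -/
def circuitsOf {n : ℕ} (𝓑 : Set (Finset (SignedElt n))) : Set (Finset (SignedElt n)) :=
  {C | Minimal (fun S => Admissible S ∧ ∀ B ∈ 𝓑, ¬ S ⊆ B) C}

/-- `𝒞` is the collection of circuits of some symplectic matroid on `E_{±n}`. -/
def IsCircuits {n : ℕ} (𝒞 : Set (Finset (SignedElt n))) : Prop :=
  ∃ 𝓑 : Set (Finset (SignedElt n)), IsBases 𝓑 ∧ circuitsOf 𝓑 = 𝒞

/-- The maximal admissible sets that contain no member of `𝒞`. -/
def basesOf {n : ℕ} (𝒞 : Set (Finset (SignedElt n))) : Set (Finset (SignedElt n)) :=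
  {B | Maximal (fun S => Admissible S ∧ ∀ C ∈ 𝒞, ¬ C ⊆ S) B}

/-- `P` spans `x` (with respect to `𝒞`) if `J - P = {x}` for some `J ∈ 𝒞`. -/
def Spans {n : ℕ} (𝒞 : Set (Finset (SignedElt n))) (P : Finset (SignedElt n))
    (x : SignedElt n) : Prop :=
  ∃ J ∈ 𝒞, J \ P = {x}

/-- The circuit axioms (SC1) - (SC4). -/
structure CircuitAxioms {n : ℕ} (𝒞 : Set (Finset (SignedElt n))) : Prop where
  sc1 : ∅ ∉ 𝒞
  sc2 : ∀ C₁ ∈ 𝒞, ∀ C₂ ∈ 𝒞, C₁ ⊆ C₂ → C₁ = C₂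
  sc3 : ∀ C₁ ∈ 𝒞, ∀ C₂ ∈ 𝒞, C₁ ≠ C₂ → ∀ x ∈ C₁ ∩ C₂, Admissible (C₁ ∪ C₂) →
    ∃ C ∈ 𝒞, C ⊆ (C₁ ∪ C₂) \ {x}
  sc4 : ∀ P : Finset (SignedElt n), Admissible P → ∀ B ∈ basesOf 𝒞, P.card < B.card →
    ¬ ∀ x, x ∉ P ∪ starSet P → Spans 𝒞 P x

/-- The edge set `D` is a (single) cycle of the multigraph `G`: for some `m`, its edges are
`e 0, …, e m` (distinct), and `e i` joins `v i` to `v (i + 1)`, where `v 0, …, v m` are distinct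
vertices and the indices are taken modulo `m + 1`. Loops are the cycles with one edge, pairs of
parallel edges the cycles with two edges. -/
def IsCycle {V : Type*} {n : ℕ} (G : Graph V (Fin n)) (D : Finset (Fin n)) : Prop :=
  ∃ (m : ℕ) (v : Fin (m + 1) → V) (e : Fin (m + 1) → Fin n),
    Function.Injective v ∧ Function.Injective e ∧
    (∀ i, G.IsLink (e i) (v i) (v (i + 1))) ∧ Finset.univ.image e = D

/-- The edges of the connected component of the vertex `r` in the spanning subgraph of `G` with
edge set `X`. -/
def componentEdges {V : Type*} {n : ℕ} (G : Graph V (Fin n)) (X : Finset (Fin n)) (r : V) :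
    Set (Fin n) :=
  {e | e ∈ X ∧ ∃ v, G.Inc e v ∧ Relation.ReflTransGen (G.restrict (X : Set (Fin n))).Adj r v}

/-- For the signed graph `(G, σ)` (the edge `e` is negative iff `σ e = true`), the cycle `D` is
unbalanced: the product of its signs is negative. -/
def Unbalanced {n : ℕ} (σ : Fin n → Bool) (D : Finset (Fin n)) : Prop :=
  Odd (D.filter (fun e => σ e = true)).card

/-- Independence in the signed-graphic matroid of `(G, σ)`: every connected component of the edge
set `X` is a tree (contains no cycle), or is unicyclic and its unique cycle is unbalanced. -/
def SignedGraphicIndep {V : Type*} {n : ℕ} (G : Graph V (Fin n)) (σ : Fin n → Bool)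
    (X : Finset (Fin n)) : Prop :=
  ∀ r ∈ G.vertexSet,
    (∀ D, IsCycle G D → ¬ (D : Set (Fin n)) ⊆ componentEdges G X r) ∨
    (∃ D, (IsCycle G D ∧ (D : Set (Fin n)) ⊆ componentEdges G X r) ∧
      (∀ D', IsCycle G D' → (D' : Set (Fin n)) ⊆ componentEdges G X r → D' = D) ∧
      Unbalanced σ D)

/-- The union, over all `2 ^ n` signings `σ` of `G`, of the families of circuits (minimal dependent
sets) of the signed-graphic matroid of `(G, σ)`, whose ground set consists of the
signed edges: `i` if the `i`-th edge is positive, `i*` if it is negative. -/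
def signedGraphicCircuits {V : Type*} {n : ℕ} (G : Graph V (Fin n)) :
    Set (Finset (SignedElt n)) :=
  {S | ∃ (σ : Fin n → Bool) (X : Finset (Fin n)),
    Minimal (fun Y => ¬ SignedGraphicIndep G σ Y) X ∧ S = X.image (fun i => ⟨i, σ i⟩)}

/-- `G(S)`, the set of the edges `i` such that `i ∈ S` or `i* ∈ S`. -/
def underlyingEdges {n : ℕ} (S : Finset (SignedElt n)) : Finset (Fin n) :=
  S.image SignedElt.idx

/-- The set of the edges `i` such that `i* ∈ S`. -/
def negEdges {n : ℕ} (S : Finset (SignedElt n)) : Finset (Fin n) :=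
  Finset.univ.filter (fun i => (⟨i, true⟩ : SignedElt n) ∈ S)

/-- The admissible sets `S` with an even number of negative edges such that `G(S)` is a cycle, or
is a union of one or more cycles each of which has an odd number of negative edges. -/
def cycleFamily {V : Type*} {n : ℕ} (G : Graph V (Fin n)) : Set (Finset (SignedElt n)) :=
  {S | Admissible S ∧
    ((IsCycle G (underlyingEdges S) ∧ Even (negEdges S).card) ∨
      ((∃ 𝒟 : Finset (Finset (Fin n)), 𝒟.Nonempty ∧ 𝒟.biUnion id = underlyingEdges S ∧
          ∀ D ∈ 𝒟, IsCycle G D ∧ Odd (D ∩ negEdges S).card) ∧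
        Even (negEdges S).card))}

/-- The members of `cycleFamily G` that are minimal under inclusion. -/
def minimalCycleFamily {V : Type*} {n : ℕ} (G : Graph V (Fin n)) :
    Set (Finset (SignedElt n)) :=
  {S | Minimal (fun T => T ∈ cycleFamily G) S}

end SymplecticMatroid

/-!
A family of vectors `φ` on `E_{±n}` gives the family of all minimal admissible sets on which `φ` is
linearly dependent (`admCircuits`). Both families of the theorem are of this kind. The
circuits of the signed-graphic matroids arise over `ℚ` from `i ↦ e_u - e_v` and `i* ↦ e_u + e_v`,
where `u` and `v` are the ends of the edge `i` (`signedGraphicCircuits_eq`). The minimal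
members of `cycleFamily` arise over the field with two elements from `i ↦ (e_u + e_v, 0)` and
`i* ↦ (e_u + e_v, 1)` (`minimalCycleFamily_eq`).

Linear algebra gives (SC1)-(SC3) for every such `φ`. What is special to the two configurations is
the property `SplitsStars`. For a subspace `U` it provides a part `Z` of `U` and a subspace `R`
independent of `Z` such that each edge with a vector in `U` has both its vectors in `Z` or both in
`R`, the former if `U` contains both of them. For signed graphs `Z` is spanned by the unit
vectors in `U`, because `2 e_u` and `2 e_v` are combinations of `e_u - e_v` and `e_u + e_v`. For the
even-cycle configuration `Z` is `U` or `0`, according as `(0, 1)` lies in `U` or not.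

The property yields the rank comparison `card_le_of_splitsStars`, which has two applications.
Without one-signed elements it gives (SC4) and the equicardinality of the bases. With them, applied
to a final segment of an admissible ordering, it shows that the basis found by the greedy algorithm
has at least as many elements in that segment as every other basis
(`exists_dominating_base`). Hence the greedy basis dominates all others in the induced ordering.

The two identifications rest on one fact about multigraphs, `exists_isCycle_subset`: a nonempty edge
set without a vertex of degree one, apart from at most one vertex, contains a cycle. Over any field,
a combination of the vectors of the edges of a forest that is a multiple of a unit vector is
therefore trivial (`coeff_eq_zero_of_acyclic`).
-/

namespace SymplecticMatroid

open Submodule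

/-! ### Spans and cardinalities -/

section Linear

variable {ι K W : Type*} [Field K] [AddCommGroup W] [Module K W]

lemma card_le_of_linearIndepOn_of_mem_span {φ : ι → W} {A P : Finset ι}
    (hA : LinearIndepOn K φ (A : Set ι)) (hAP : ∀ x ∈ A, φ x ∈ span K (φ '' P)) :
    A.card ≤ P.card := by
  classical
  have hfin : Module.Finite K (span K (φ '' (P : Set ι))) :=
    Module.Finite.span_of_finite K (P.finite_toSet.image φ)
  have h1 : Module.finrank K (span K (φ '' (P : Set ι))) ≤ P.card := by
    have := finrank_span_finset_le_card (R := K) (P.image φ)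
    rw [Finset.coe_image] at this
    exact this.trans Finset.card_image_le
  have h2 : LinearIndependent K
      (fun x : A => (⟨φ x, hAP x x.2⟩ : span K (φ '' (P : Set ι)))) := by
    refine LinearIndependent.of_comp (span K (φ '' (P : Set ι))).subtype ?_
    exact hA
  have h3 := h2.fintype_card_le_finrank
  simp only [Fintype.card_coe] at h3
  exact h3.trans h1

/-- If a family of vectors is distributed over two independent subspaces, then a vector of one of
them that lies in the span of the family lies in the span of the members of that subspace. -/
lemma mem_span_filter_of_disjoint {φ : ι → W} {P : Finset ι} {Z R : Submodule K W}
    (hZR : Disjoint Z R) (p : ι → Prop) [DecidablePred p]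
    (hZ : ∀ x ∈ P, p x → φ x ∈ Z) (hR : ∀ x ∈ P, ¬ p x → φ x ∈ R) {w : W}
    (hw : w ∈ span K (φ '' P)) (hwZ : w ∈ Z) : w ∈ span K (φ '' (P.filter p)) := by
  classical
  have hP : (φ '' (P : Set ι)) = φ '' (P.filter p) ∪ φ '' (P.filter (fun x => ¬ p x)) := by
    rw [← Set.image_union, ← Finset.coe_union, Finset.filter_union_filter_not_eq]
  rw [hP, span_union, mem_sup] at hw
  obtain ⟨y, hy, y', hy', rfl⟩ := hw
  have hyZ : y ∈ Z := by
    refine (span_le.2 ?_) hy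
    rintro _ ⟨x, hx, rfl⟩
    simp only [Finset.coe_filter, Set.mem_ofPred_eq] at hx
    exact hZ x hx.1 hx.2
  have hyR : y' ∈ R := by
    refine (span_le.2 ?_) hy'
    rintro _ ⟨x, hx, rfl⟩
    simp only [Finset.coe_filter, Set.mem_ofPred_eq] at hx
    exact hR x hx.1 hx.2
  have h0 : y' = 0 := by
    refine (disjoint_def.1 hZR) y' ?_ hyR
    simpa using Z.sub_mem hwZ hyZ
  simpa [h0] using hy

lemma mem_span_of_not_linearIndepOn_insert [DecidableEq ι] {φ : ι → W} {P : Finset ι} {x : ι}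
    (hP : LinearIndepOn K φ (P : Set ι))
    (hx : ¬ LinearIndepOn K φ ((insert x P : Finset ι) : Set ι)) :
    φ x ∈ span K (φ '' P) := by
  by_contra h
  exact hx (by rw [Finset.coe_insert]; exact hP.insert h)

lemma mem_span_erase_of_minimal [DecidableEq ι] {φ : ι → W} {p : Finset ι → Prop}
    (hp : ∀ {S T : Finset ι}, S ⊆ T → p T → p S) {C : Finset ι}
    (hC : Minimal (fun S : Finset ι => p S ∧ ¬ LinearIndepOn K φ (S : Set ι)) C) {x : ι}
    (hx : x ∈ C) : φ x ∈ span K (φ '' (C.erase x)) := by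
  have h1 : LinearIndepOn K φ ((C.erase x : Finset ι) : Set ι) := by
    by_contra h
    have := hC.2 (y := C.erase x) ⟨hp (Finset.erase_subset _ _) hC.1.1, h⟩
      (Finset.erase_subset _ _) hx
    simp at this
  refine mem_span_of_not_linearIndepOn_insert h1 ?_
  rw [Finset.insert_erase hx]
  exact hC.1.2

end Linear

/-! ### Admissible sets -/

section Admissible

variable {n : ℕ}

@[simp] lemma star_star (x : SignedElt n) : x.star.star = x := by
  cases x; simp [SignedElt.star]

lemma star_ne (x : SignedElt n) : x.star ≠ x := by
  cases x; simp [SignedElt.star]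

lemma eq_or_eq_star_of_idx_eq {x y : SignedElt n} (h : x.idx = y.idx) : x = y ∨ x = y.star := by
  obtain ⟨i, s⟩ := x
  obtain ⟨j, t⟩ := y
  cases s <;> cases t <;> simp_all [SignedElt.star]

lemma mem_starSet {S : Finset (SignedElt n)} {x : SignedElt n} :
    x ∈ starSet S ↔ x.star ∈ S := by
  simp only [starSet, Finset.mem_image]
  constructor
  · rintro ⟨y, hy, rfl⟩
    simpa using hy
  · intro h
    exact ⟨_, h, star_star x⟩

lemma admissible_iff {S : Finset (SignedElt n)} :
    Admissible S ↔ ∀ x ∈ S, x.star ∉ S := by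
  simp only [Admissible, Finset.eq_empty_iff_forall_notMem, Finset.mem_inter, mem_starSet, not_and]

lemma Admissible.subset {S T : Finset (SignedElt n)} (h : S ⊆ T) (hT : Admissible T) :
    Admissible S := by
  rw [admissible_iff] at *
  exact fun x hx hx' => hT x (h hx) (h hx')

lemma Admissible.injOn_idx {S : Finset (SignedElt n)} (hS : Admissible S) :
    Set.InjOn SignedElt.idx (S : Set (SignedElt n)) := by
  intro x hx y hy h
  rcases eq_or_eq_star_of_idx_eq h with h | h
  · exact h
  · subst h
    exact absurd hx (admissible_iff.1 hS y hy)

lemma Admissible.insert {S : Finset (SignedElt n)} (hS : Admissible S) {x : SignedElt n}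
    (hx : x.star ∉ S) : Admissible (insert x S) := by
  rw [admissible_iff] at *
  intro y hy hy'
  rw [Finset.mem_insert] at hy hy'
  rcases hy with rfl | hy <;> rcases hy' with h | hy'
  · exact star_ne _ h
  · exact hx hy'
  · subst h
    exact hx (by simpa using hy)
  · exact hS y hy hy'

end Admissible

/-! ### Vector configurations on signed elements -/

section Configuration

variable {n : ℕ} {K W : Type*} [Field K] [AddCommGroup W] [Module K W]

variable (K) in
/-- For every subspace `U` there are a subspace `Z` of `U` and a subspace `R` independent of `Z`
such that whenever `φ x ∈ U`, both `φ x` and `φ x*` lie in `Z` or both lie in `R`, according as the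
index of `x` belongs to `z` or not. Moreover `z` contains every index both of whose vectors are in `U`.
The condition on the indices is kept apart from membership in `Z`, since the vector of a positive
loop is zero and so lies in `R` as well. -/
def SplitsStars (φ : SignedElt n → W) : Prop :=
  ∀ U : Submodule K W, ∃ (Z R : Submodule K W) (z : Set (Fin n)), Disjoint Z R ∧ Z ≤ U ∧
    (∀ x, φ x ∈ U → x.idx ∈ z → φ x ∈ Z ∧ φ x.star ∈ Z) ∧
    (∀ x, φ x ∈ U → x.idx ∉ z → φ x ∈ R ∧ φ x.star ∈ R) ∧
    (∀ x, φ x ∈ U → φ x.star ∈ U → x.idx ∈ z)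

variable (K) in
/-- The admissible sets on which the vectors are linearly independent. -/
def AdmIndep (φ : SignedElt n → W) (S : Finset (SignedElt n)) : Prop :=
  Admissible S ∧ LinearIndepOn K φ (S : Set (SignedElt n))

variable (K) in
/-- The minimal admissible sets on which the vectors are linearly dependent. -/
def admCircuits (φ : SignedElt n → W) : Set (Finset (SignedElt n)) :=
  {C | Minimal (fun S : Finset (SignedElt n) =>
    Admissible S ∧ ¬ LinearIndepOn K φ (S : Set (SignedElt n))) C}

variable {φ : SignedElt n → W}

lemma AdmIndep.subset {S T : Finset (SignedElt n)} (h : S ⊆ T) (hT : AdmIndep K φ T) :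
    AdmIndep K φ S :=
  ⟨hT.1.subset h, hT.2.mono (by exact_mod_cast h)⟩

/-- The rank comparison on which the circuit axiom (SC4) and the optimality of the greedy basis
both rest. The set `F` contains the elements for which only one sign is available;
for the other indices outside `P`, both signs are spanned by `P`. -/
lemma card_le_of_splitsStars (hφ : SplitsStars K φ) {P A : Finset (SignedElt n)}
    (F : Set (SignedElt n)) (hA : AdmIndep K φ A)
    (hF : ∀ x ∈ A, x ∈ F → φ x ∈ span K (φ '' ((P : Set (SignedElt n)) ∩ F)))
    (hD : ∀ x ∈ A, x ∉ F → x.star ∉ F ∧ ((x ∈ P ∨ x.star ∈ P) ∨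
      (φ x ∈ span K (φ '' P) ∧ φ x.star ∈ span K (φ '' P)))) :
    A.card ≤ P.card := by
  classical
  obtain ⟨Z, R, z, hZR, hZU, hz, hnz, hboth⟩ := hφ (span K (φ '' P))
  set U := span K (φ '' (P : Set (SignedElt n))) with hU
  have hPU : ∀ x ∈ P, φ x ∈ U := fun x hx => subset_span ⟨x, hx, rfl⟩
  have hFU : ∀ x ∈ A, x ∈ F → φ x ∈ U := fun x hx hxF =>
    span_mono (Set.image_mono Set.inter_subset_left) (hF x hx hxF)
  -- `A` and `P` are compared on three parts: `z`, the rest inside `F`, and the rest outside `F`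
  let p : SignedElt n → Prop := fun x => x.idx ∈ z
  have hAZ : ∀ x ∈ A, p x → φ x ∈ Z := by
    intro x hx hpx
    by_cases hxF : x ∈ F
    · exact (hz x (hFU x hx hxF) hpx).1
    · rcases (hD x hx hxF).2 with (h | h) | h
      · exact (hz x (hPU x h) hpx).1
      · simpa using (hz x.star (hPU _ h) hpx).2
      · exact (hz x h.1 hpx).1
  have c1 : (A.filter p).card ≤ (P.filter p).card := by
    refine card_le_of_linearIndepOn_of_mem_span (K := K) (φ := φ)
      (hA.2.mono (by exact_mod_cast Finset.filter_subset _ _)) ?_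
    intro x hx
    rw [Finset.mem_filter] at hx
    have hxZ := hAZ x hx.1 hx.2
    exact mem_span_filter_of_disjoint hZR p (fun y hy hpy => (hz y (hPU y hy) hpy).1)
      (fun y hy hpy => (hnz y (hPU y hy) hpy).1) (hZU hxZ) hxZ
  have c2 : ((A.filter (fun x => ¬ p x)).filter (· ∈ F)).card
      ≤ ((P.filter (fun x => ¬ p x)).filter (· ∈ F)).card := by
    refine card_le_of_linearIndepOn_of_mem_span (K := K) (φ := φ) (hA.2.mono ?_) ?_
    · exact_mod_cast (Finset.filter_subset _ _).trans (Finset.filter_subset _ _)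
    intro x hx
    simp only [Finset.mem_filter] at hx
    obtain ⟨⟨hxA, hpx⟩, hxF⟩ := hx
    rw [Finset.filter_comm]
    refine mem_span_filter_of_disjoint hZR.symm (fun x => ¬ p x) ?_ ?_ ?_
      (hnz x (hFU x hxA hxF) hpx).1
    · intro y hy hpy
      exact (hnz y (hPU y (Finset.mem_of_mem_filter y hy)) hpy).1
    · intro y hy hpy
      exact (hz y (hPU y (Finset.mem_of_mem_filter y hy)) (not_not.1 hpy)).1
    · convert hF x hxA hxF using 3
      ext; simp
  have c3 : ((A.filter (fun x => ¬ p x)).filter (· ∉ F)).card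
      ≤ ((P.filter (fun x => ¬ p x)).filter (· ∉ F)).card := by
    rw [← Finset.card_image_of_injOn (f := SignedElt.idx)
      (s := (A.filter (fun x => ¬ p x)).filter (· ∉ F))
      (hA.1.injOn_idx.mono (by
        exact_mod_cast (Finset.filter_subset _ _).trans (Finset.filter_subset _ _)))]
    refine (Finset.card_le_card ?_).trans (Finset.card_image_le (f := SignedElt.idx))
    intro i hi
    simp only [Finset.mem_image, Finset.mem_filter] at hi ⊢
    obtain ⟨x, ⟨⟨hxA, hpx⟩, hxF⟩, rfl⟩ := hi
    obtain ⟨hxF', (h | h) | h⟩ := hD x hxA hxF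
    · exact ⟨x, ⟨⟨h, hpx⟩, hxF⟩, rfl⟩
    · exact ⟨x.star, ⟨⟨h, hpx⟩, hxF'⟩, rfl⟩
    · exact absurd (hboth x h.1 h.2) hpx
  have e1 := Finset.card_filter_add_card_filter_not (s := A) p
  have e2 := Finset.card_filter_add_card_filter_not (s := P) p
  have e3 := Finset.card_filter_add_card_filter_not (s := A.filter (fun x => ¬ p x)) (· ∈ F)
  have e4 := Finset.card_filter_add_card_filter_not (s := P.filter (fun x => ¬ p x)) (· ∈ F)
  omega

lemma exists_admCircuits_subset {S : Finset (SignedElt n)} (hS : Admissible S)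
    (hd : ¬ LinearIndepOn K φ (S : Set (SignedElt n))) : ∃ C ∈ admCircuits K φ, C ⊆ S := by
  obtain ⟨C, hCS, hC⟩ := exists_minimal_le_of_wellFoundedLT
    (fun S : Finset (SignedElt n) => Admissible S ∧ ¬ LinearIndepOn K φ (S : Set (SignedElt n)))
    S ⟨hS, hd⟩
  exact ⟨C, hC, hCS⟩

lemma admIndep_iff_forall_circuits {S : Finset (SignedElt n)} :
    (Admissible S ∧ ∀ C ∈ admCircuits K φ, ¬ C ⊆ S) ↔ AdmIndep K φ S := by
  constructor
  · rintro ⟨h, h'⟩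
    refine ⟨h, ?_⟩
    by_contra hd
    obtain ⟨C, hC, hCS⟩ := exists_admCircuits_subset h hd
    exact h' C hC hCS
  · rintro ⟨h, h'⟩
    refine ⟨h, fun C hC hCS => hC.1.2 (h'.mono (by exact_mod_cast hCS))⟩

lemma mem_basesOf_admCircuits {B : Finset (SignedElt n)} :
    B ∈ basesOf (admCircuits K φ) ↔ Maximal (AdmIndep K φ) B := by
  simp only [basesOf, Set.mem_ofPred_eq, admIndep_iff_forall_circuits]

lemma mem_span_of_spans {P : Finset (SignedElt n)} {x : SignedElt n}
    (h : Spans (admCircuits K φ) P x) : φ x ∈ span K (φ '' P) := by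
  obtain ⟨J, hJ, hJP⟩ := h
  have hx : x ∈ J \ P := by simp [hJP]
  rw [Finset.mem_sdiff] at hx
  have h1 := mem_span_erase_of_minimal (fun h hT => Admissible.subset h hT) hJ hx.1
  refine span_mono (Set.image_mono ?_) h1
  intro y hy
  rw [Finset.mem_coe, Finset.mem_erase] at hy
  by_contra hyP
  have : y ∈ J \ P := Finset.mem_sdiff.2 ⟨hy.2, hyP⟩
  rw [hJP, Finset.mem_singleton] at this
  exact hy.1 this

/-- In (SC3), an element of `C₁` outside `C₂` stays spanned by the other elements of `C₁ ∪ C₂` after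
`x` is removed, since `C₂` spans `x`. (SC4) is the rank comparison without one-signed elements. -/
lemma circuitAxioms_admCircuits (hφ : SplitsStars K φ) : CircuitAxioms (admCircuits K φ) where
  sc1 h := h.1.2 (by simp)
  sc2 C₁ h₁ C₂ h₂ h := le_antisymm h (h₂.2 h₁.1 h)
  sc3 := by
    intro C₁ h₁ C₂ h₂ hne x hx hadm
    rw [Finset.mem_inter] at hx
    obtain ⟨y, hy₁, hy₂⟩ : ∃ y ∈ C₁, y ∉ C₂ := by
      by_contra! h
      exact hne (le_antisymm h (h₂.2 h₁.1 h))
    have hxy : x ≠ y := by rintro rfl; exact hy₂ hx.2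
    refine exists_admCircuits_subset (hadm.subset Finset.sdiff_subset) fun hI => ?_
    have hyI : y ∈ (((C₁ ∪ C₂) \ {x} : Finset (SignedElt n)) : Set (SignedElt n)) := by
      simp [hy₁, hxy.symm]
    refine hI.notMem_span hyI ?_
    set U := span K (φ '' ((((C₁ ∪ C₂) \ {x} : Finset (SignedElt n)) : Set (SignedElt n)) \ {y}))
      with hU
    have hxU : φ x ∈ U := by
      refine span_mono (Set.image_mono ?_)
        (mem_span_erase_of_minimal (fun h hT => Admissible.subset h hT) h₂ hx.2)
      intro w hw
      have hwy : w ≠ y := by rintro rfl; exact hy₂ (Finset.mem_of_mem_erase hw)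
      simp_all
    refine (span_le.2 ?_)
      (mem_span_erase_of_minimal (fun h hT => Admissible.subset h hT) h₁ hy₁)
    rintro _ ⟨w, hw, rfl⟩
    by_cases hwx : w = x
    · subst hwx; exact hxU
    · refine subset_span ⟨w, ?_, rfl⟩
      simp_all
  sc4 := by
    intro P hP B hB hlt hspan
    rw [mem_basesOf_admCircuits] at hB
    refine absurd (card_le_of_splitsStars hφ ∅ hB.1 (P := P) (by simp) ?_) (not_le.2 hlt)
    intro x hx _
    refine ⟨by simp, ?_⟩
    by_cases h : x ∈ P ∨ x.star ∈ P
    · exact Or.inl h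
    · have h1 : x ∉ P ∪ starSet P := by simpa [mem_starSet] using h
      have h2 : x.star ∉ P ∪ starSet P := by simpa [mem_starSet, and_comm, or_comm] using h
      exact Or.inr ⟨mem_span_of_spans (hspan x h1), mem_span_of_spans (hspan _ h2)⟩

lemma AdmIndep.exists_maximal {S : Finset (SignedElt n)} (hS : AdmIndep K φ S) :
    ∃ B, S ⊆ B ∧ Maximal (AdmIndep K φ) B :=
  exists_maximal_ge_of_wellFoundedGT (AdmIndep K φ) S hS

lemma admIndep_empty : AdmIndep K φ ∅ :=
  ⟨by simp [Admissible], by simp⟩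

lemma card_le_of_maximal_admIndep (hφ : SplitsStars K φ) {A B : Finset (SignedElt n)}
    (hA : Maximal (AdmIndep K φ) A) (hB : AdmIndep K φ B) : B.card ≤ A.card := by
  have key : ∀ x, ¬ (x ∈ A ∨ x.star ∈ A) → φ x ∈ span K (φ '' A) := by
    intro x hx
    push Not at hx
    refine mem_span_of_not_linearIndepOn_insert hA.1.2 fun h => hx.1 ?_
    exact hA.2 ⟨hA.1.1.insert hx.2, h⟩ (Finset.subset_insert _ _) (Finset.mem_insert_self _ _)
  refine card_le_of_splitsStars hφ ∅ hB (by simp) fun x _ _ => ⟨by simp, ?_⟩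
  by_cases h : x ∈ A ∨ x.star ∈ A
  · exact Or.inl h
  · exact Or.inr ⟨key x h, key x.star (by simpa [or_comm] using h)⟩

lemma circuitsOf_basesOf_admCircuits :
    circuitsOf (basesOf (admCircuits K φ)) = admCircuits K φ := by
  have h : ∀ S : Finset (SignedElt n),
      (Admissible S ∧ ∀ B ∈ basesOf (admCircuits K φ), ¬ S ⊆ B) ↔
      (Admissible S ∧ ¬ LinearIndepOn K φ (S : Set (SignedElt n))) := by
    refine fun S => and_congr_right fun hS => ?_
    constructor
    · intro h hI
      obtain ⟨B, hSB, hB⟩ := AdmIndep.exists_maximal (K := K) (φ := φ) ⟨hS, hI⟩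
      exact h B (mem_basesOf_admCircuits.2 hB) hSB
    · intro h B hB hSB
      exact h ((mem_basesOf_admCircuits.1 hB).1.subset hSB).2
  rw [circuitsOf, funext fun S => propext (h S), admCircuits]

end Configuration

/-! ### The induced ordering and greedy bases -/

section Greedy

/-- Sorted lists of equal length are compared entrywise by counting the entries above each
threshold. -/
lemma forall₂_le_of_countP_le {α : Type*} [LinearOrder α] :
    ∀ {l₁ l₂ : List α}, l₁.Pairwise (· ≤ ·) → l₂.Pairwise (· ≤ ·) → l₁.length = l₂.length →
      (∀ t, l₁.countP (fun a => decide (t ≤ a)) ≤ l₂.countP (fun a => decide (t ≤ a))) →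
      List.Forall₂ (· ≤ ·) l₁ l₂
  | [], [], _, _, _, _ => .nil
  | [], _ :: _, _, _, h, _ => by simp at h
  | _ :: _, [], _, _, h, _ => by simp at h
  | a :: l₁, b :: l₂, h₁, h₂, hl, hc => by
    rw [List.pairwise_cons] at h₁ h₂
    have hlen : l₁.length = l₂.length := by simpa using hl
    have full : ∀ {l : List α} {t : α}, (∀ x ∈ l, t ≤ x) →
        l.countP (fun a => decide (t ≤ a)) = l.length := by
      intro l t h
      rw [List.countP_eq_length]
      simpa using h
    have hab : a ≤ b := by
      by_contra hba
      have h := hc a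
      have h' := List.countP_le_length (p := fun x => decide (a ≤ x)) (l := l₂)
      rw [List.countP_cons, List.countP_cons, full h₁.1] at h
      simp only [le_refl, decide_true, if_true, hba, decide_false] at h
      simp at h
      omega
    refine .cons hab (forall₂_le_of_countP_le h₁.2 h₂.2 hlen fun t => ?_)
    by_cases htb : t ≤ b
    · rw [full fun x hx => htb.trans (h₂.1 x hx), ← hlen]
      exact List.countP_le_length
    · have hta : ¬ t ≤ a := fun h => htb (h.trans hab)
      have h := hc t
      rw [List.countP_cons, List.countP_cons] at h
      simpa [htb, hta] using h

lemma forall₂_le_antisymm {α : Type*} [LinearOrder α] {l₁ l₂ : List α}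
    (h : List.Forall₂ (· ≤ ·) l₁ l₂) (h' : List.Forall₂ (· ≤ ·) l₂ l₁) : l₁ = l₂ := by
  induction h with
  | nil => rfl
  | cons hab _ ih =>
    cases h' with
    | cons hba h' => rw [le_antisymm hab hba, ih h']

variable {n : ℕ} {K W : Type*} [Field K] [AddCommGroup W] [Module K W] {φ : SignedElt n → W}

lemma inducedLE_of_card_filter_le (L : LinearOrder (SignedElt n)) {A B : Finset (SignedElt n)}
    (hc : A.card = B.card)
    (h : ∀ t, (A.filter (fun a => L.le t a)).card ≤ (B.filter (fun a => L.le t a)).card) :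
    inducedLE L A B := by
  have key : ∀ (S : Finset (SignedElt n)) (t : SignedElt n),
      (S.sort (fun a b => L.le a b)).countP (fun a => decide (L.le t a)) =
        (S.filter (fun a => L.le t a)).card := by
    intro S t
    rw [Finset.card_def, Finset.filter_val, ← Multiset.countP_eq_card_filter,
      ← Finset.sort_eq S (fun a b => L.le a b), Multiset.coe_countP]
  refine forall₂_le_of_countP_le (Finset.pairwise_sort _ _) (Finset.pairwise_sort _ _) ?_ ?_
  · rw [Finset.length_sort, Finset.length_sort, hc]
  · intro t
    rw [key, key]
    exact h t

lemma inducedLE_antisymm (L : LinearOrder (SignedElt n)) {A B : Finset (SignedElt n)}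
    (h : inducedLE L A B) (h' : inducedLE L B A) : A = B := by
  have := forall₂_le_antisymm h h'
  rw [← Finset.sort_toFinset A (fun a b => L.le a b),
    ← Finset.sort_toFinset B (fun a b => L.le a b), this]

/-- The greedy algorithm, running through `T` in decreasing order: every rejected element forms
with the larger chosen ones a set that is not independent. -/
lemma exists_greedy [LinearOrder (SignedElt n)] (T : Finset (SignedElt n)) :
    ∃ P ⊆ T, AdmIndep K φ P ∧
      ∀ x ∈ T, x ∈ P ∨ ¬ AdmIndep K φ (insert x (P.filter (x < ·))) := by
  classical
  induction T using Finset.induction_on_min with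
  | empty => exact ⟨∅, le_rfl, admIndep_empty, by simp⟩
  | insert a T ha ih =>
    obtain ⟨P, hPT, hP, hmax⟩ := ih
    by_cases h : AdmIndep K φ (insert a P)
    · refine ⟨insert a P, Finset.insert_subset_insert a hPT, h, ?_⟩
      intro x hx
      rw [Finset.mem_insert] at hx
      rcases hx with rfl | hx
      · exact Or.inl (Finset.mem_insert_self _ _)
      · rcases hmax x hx with h' | h'
        · exact Or.inl (Finset.mem_insert_of_mem h')
        · refine Or.inr ?_
          rwa [Finset.filter_insert, if_neg (ha x hx).not_gt]
    · refine ⟨P, hPT.trans (Finset.subset_insert _ _), hP, ?_⟩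
      intro x hx
      rw [Finset.mem_insert] at hx
      rcases hx with rfl | hx
      · refine Or.inr ?_
        rwa [Finset.filter_true_of_mem fun y hy => ha y (hPT hy)]
      · exact hmax x hx

/-- The greedy basis dominates all bases. In the final segment above `t`, an element `x` whose star
is not in the segment can only be rejected because of larger elements of the same kind, by the
admissibility of the ordering; these elements form the set `F` of the rank comparison. -/
lemma exists_dominating_base (hφ : SplitsStars K φ) (L : LinearOrder (SignedElt n))
    (hL : AdmissibleOrder L) :
    ∃ B, Maximal (AdmIndep K φ) B ∧ ∀ A, Maximal (AdmIndep K φ) A → inducedLE L A B := by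
  classical
  let _ := L
  obtain ⟨P, -, hP, hmax⟩ := exists_greedy (K := K) (φ := φ) Finset.univ
  replace hmax := fun x => hmax x (Finset.mem_univ x)
  have hPm : Maximal (AdmIndep K φ) P := by
    refine ⟨hP, fun Q hQ hPQ x hx => ?_⟩
    rcases hmax x with h | h
    · exact h
    · refine absurd (hQ.subset ?_) h
      exact Finset.insert_subset hx ((Finset.filter_subset _ _).trans hPQ)
  refine ⟨P, hPm, fun A hA => ?_⟩
  refine inducedLE_of_card_filter_le L (le_antisymm (card_le_of_maximal_admIndep hφ hPm hA.1)
    (card_le_of_maximal_admIndep hφ hA hPm.1)) fun t => ?_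
  change (A.filter (t ≤ ·)).card ≤ (P.filter (t ≤ ·)).card
  -- a rejected element is spanned by the larger chosen ones unless its star is among them
  have hspan : ∀ x, x ∉ P → x.star ∉ P.filter (x < ·) →
      φ x ∈ span K (φ '' (P.filter (x < ·))) := by
    intro x hx hx'
    have hI := hP.subset (Finset.filter_subset (x < ·) P)
    refine mem_span_of_not_linearIndepOn_insert hI.2 fun h => ?_
    exact ((hmax x).resolve_left hx) ⟨hI.1.insert hx', h⟩
  refine card_le_of_splitsStars hφ {x | t ≤ x ∧ ¬ t ≤ x.star}
    (hA.1.subset (Finset.filter_subset _ _)) ?_ ?_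
  · rintro x - ⟨hx, hx'⟩
    by_cases hxP : x ∈ P
    · exact subset_span ⟨x, ⟨by simp [hxP, hx], hx, hx'⟩, rfl⟩
    · refine span_mono (Set.image_mono ?_) (hspan x hxP ?_)
      · intro y hy
        simp only [Finset.coe_filter, Set.mem_ofPred_eq] at hy
        refine ⟨by simp [hy.1, hx.trans hy.2.le], hx.trans hy.2.le, fun h => hx' ?_⟩
        exact h.trans (hL _ _ hy.2).le
      · intro h
        exact hx' (hx.trans (Finset.mem_filter.1 h).2.le)
  · intro x hx hxF
    have htx : t ≤ x := (Finset.mem_filter.1 hx).2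
    have htx' : t ≤ x.star := by
      by_contra h
      exact hxF ⟨htx, h⟩
    refine ⟨fun h => h.2 (by simpa using htx), ?_⟩
    by_cases h : x ∈ P ∨ x.star ∈ P
    · left
      simpa [htx, htx'] using h
    · right
      push Not at h
      have hsub : ∀ y, t ≤ y → y ∉ P → y.star ∉ P → φ y ∈ span K (φ '' (P.filter (t ≤ ·))) := by
        intro y hy h1 h2
        refine span_mono (Set.image_mono ?_)
          (hspan y h1 fun h => h2 (Finset.mem_of_mem_filter _ h))
        intro w hw
        simp only [Finset.coe_filter, Set.mem_ofPred_eq] at hw ⊢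
        exact ⟨hw.1, hy.trans hw.2.le⟩
      exact ⟨hsub x htx h.1 h.2, hsub _ htx' h.2 (by simpa using h.1)⟩

lemma isBases_basesOf_admCircuits (hφ : SplitsStars K φ) :
    IsBases (basesOf (admCircuits K φ)) where
  nonempty := by
    obtain ⟨B, -, hB⟩ := (admIndep_empty (K := K) (φ := φ)).exists_maximal
    exact ⟨B, mem_basesOf_admCircuits.2 hB⟩
  admissible B hB := (mem_basesOf_admCircuits.1 hB).1.1
  card_eq A hA B hB := by
    rw [mem_basesOf_admCircuits] at hA hB
    exact le_antisymm (card_le_of_maximal_admIndep hφ hB hA.1)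
      (card_le_of_maximal_admIndep hφ hA hB.1)
  existsUnique_maximal L hL := by
    obtain ⟨B, hB, hdom⟩ := exists_dominating_base hφ L hL
    refine ⟨B, ⟨mem_basesOf_admCircuits.2 hB, fun A hA h => ?_⟩, fun A hA => ?_⟩
    · exact inducedLE_antisymm L (hdom A (mem_basesOf_admCircuits.1 hA)) h
    · exact (hA.2 B (mem_basesOf_admCircuits.2 hB)
        (hdom A (mem_basesOf_admCircuits.1 hA.1))).symm

lemma circuitAxioms_and_isCircuits (hφ : SplitsStars K φ) :
    CircuitAxioms (admCircuits K φ) ∧ IsCircuits (admCircuits K φ) :=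
  ⟨circuitAxioms_admCircuits hφ, _, isBases_basesOf_admCircuits hφ,
    circuitsOf_basesOf_admCircuits⟩

end Greedy

/-! ### Finding cycles in multigraphs -/

section Graph

variable {V : Type*} {n : ℕ} {G : Graph V (Fin n)}

/-- A path through `v 0, …, v a` and an edge that joins its ends, different from its edges,
form a cycle. -/
lemma isCycle_of_path (v : ℕ → V) (e : ℕ → Fin n) (a : ℕ) (j : Fin n)
    (hv : Set.InjOn v (Set.Iic a)) (he : ∀ i < a, G.IsLink (e i) (v i) (v (i + 1)))
    (hj : G.IsLink j (v a) (v 0)) (hje : ∀ i < a, e i ≠ j) :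
    IsCycle G (insert j ((Finset.range a).image e)) := by
  refine ⟨a, fun i => v i, fun i => if (i : ℕ) < a then e i else j, ?_, ?_, ?_, ?_⟩
  · intro i k h
    exact Fin.ext (hv (Nat.le_of_lt_succ i.2) (Nat.le_of_lt_succ k.2) h)
  · intro i k h
    have hi := i.2
    have hk := k.2
    dsimp only at h
    split_ifs at h with h1 h2 h2
    · have l1 := he i h1
      have l2 := he k h2
      rw [h] at l1
      rcases l1.eq_and_eq_or_eq_and_eq l2 with h' | h'
      · exact Fin.ext (hv (Set.mem_Iic.2 (by omega)) (Set.mem_Iic.2 (by omega)) h'.1)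
      · have e1 := hv (Set.mem_Iic.2 (by omega)) (Set.mem_Iic.2 (by omega)) h'.1
        have e2 := hv (Set.mem_Iic.2 (by omega)) (Set.mem_Iic.2 (by omega)) h'.2
        omega
    · exact absurd h (hje _ h1)
    · exact absurd h.symm (hje _ h2)
    · exact Fin.ext (by omega)
  · intro i
    have hi := i.2
    dsimp only
    split_ifs with h
    · rw [Fin.val_add_one_of_lt (Fin.lt_def.2 (by simpa using h))]
      exact he i h
    · obtain rfl : i = Fin.last a := Fin.ext (by simp; omega)
      simpa using hj
  · ext k
    simp only [Finset.mem_image, Finset.mem_univ, true_and, Finset.mem_insert, Finset.mem_range]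
    constructor
    · rintro ⟨i, rfl⟩
      split_ifs with h
      · exact Or.inr ⟨i, h, rfl⟩
      · exact Or.inl rfl
    · rintro (rfl | ⟨i, hi, rfl⟩)
      · exact ⟨Fin.last a, by simp⟩
      · exact ⟨⟨i, by omega⟩, by simp [hi]⟩

lemma isCycle_singleton_of_isLink {i : Fin n} {x : V} (h : G.IsLink i x x) : IsCycle G {i} := by
  simpa using isCycle_of_path (fun _ => x) (fun _ => i) 0 i (by simp [Set.InjOn]) (by simp) h
    (by simp)

lemma IsCycle.nonempty {D : Finset (Fin n)} (h : IsCycle G D) : D.Nonempty := by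
  obtain ⟨m, v, e, -, -, -, rfl⟩ := h
  exact ⟨e 0, Finset.mem_image_of_mem _ (Finset.mem_univ _)⟩

/-- A nonempty set of edges contains a cycle if every vertex, with at most one exception `u`,
that is met by one of its edges is met by another one. A longest path that ends in `u`, if `u` is
met at all, can only be continued by an edge that closes a cycle. -/
lemma exists_isCycle_subset (hV : G.vertexSet.Finite) {Y : Finset (Fin n)} (hY : Y.Nonempty)
    (hYE : ∀ i ∈ Y, i ∈ G.edgeSet) (u : V)
    (h : ∀ i ∈ Y, ∀ v, G.Inc i v → v ≠ u → ∃ j ∈ Y, j ≠ i ∧ G.Inc j v) :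
    ∃ D ⊆ Y, IsCycle G D := by
  classical
  by_contra! hno
  have noloop : ∀ i ∈ Y, ∀ x, ¬ G.IsLink i x x := fun i hi x hx =>
    hno {i} (by simpa using hi) (isCycle_singleton_of_isLink hx)
  have path : ∀ m : ℕ, ∃ (v : ℕ → V) (e : ℕ → Fin n), Set.InjOn v (Set.Iic (m + 1)) ∧
      (∀ i < m + 1, e i ∈ Y ∧ G.IsLink (e i) (v i) (v (i + 1))) ∧
      (v (m + 1) = u ∨ ∀ i ∈ Y, ¬ G.Inc i u) := by
    intro m
    induction m with
    | zero =>
      obtain ⟨i, hi, x, y, hxy, hu⟩ : ∃ i ∈ Y, ∃ x y, G.IsLink i x y ∧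
          (y = u ∨ ∀ i ∈ Y, ¬ G.Inc i u) := by
        by_cases hu : ∃ i ∈ Y, G.Inc i u
        · obtain ⟨i, hi, x, hx⟩ := hu
          exact ⟨i, hi, x, u, hx.symm, Or.inl rfl⟩
        · obtain ⟨i, hi⟩ := hY
          obtain ⟨x, y, hxy⟩ := G.exists_isLink_of_mem_edgeSet (hYE i hi)
          exact ⟨i, hi, x, y, hxy, Or.inr (by simpa using hu)⟩
      have hne : x ≠ y := by rintro rfl; exact noloop i hi x hxy
      refine ⟨fun k => if k = 0 then x else y, fun _ => i, ?_, ?_, ?_⟩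
      · intro k hk l hl hkl
        simp only [Set.mem_Iic] at hk hl
        dsimp only at hkl
        split_ifs at hkl with h1 h2 h2
        · omega
        · exact absurd hkl hne
        · exact absurd hkl.symm hne
        · omega
      · intro k hk
        obtain rfl : k = 0 := by omega
        simpa using ⟨hi, hxy⟩
      · simpa using hu
    | succ m ih =>
      obtain ⟨v, e, hv, he, hu⟩ := ih
      have h0u : v 0 ≠ u := by
        rcases hu with hu | hu
        · intro h0
          have := hv (Set.mem_Iic.2 (Nat.zero_le _)) (Set.mem_Iic.2 le_rfl) (h0.trans hu.symm)
          omega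
        · intro h0
          exact hu (e 0) (he 0 (by omega)).1 (h0 ▸ (he 0 (by omega)).2.inc_left)
      obtain ⟨j, hj, hje, w, hw⟩ := h (e 0) (he 0 (by omega)).1 (v 0)
        (he 0 (by omega)).2.inc_left h0u
      by_cases hwv : ∃ a ≤ m + 1, v a = w
      · -- the path closes up to a cycle
        obtain ⟨a, ha, rfl⟩ := hwv
        refine absurd (isCycle_of_path v e a j (hv.mono (Set.Iic_subset_Iic.2 ha))
          (fun i hi => (he i (by omega)).2) hw.symm ?_) (hno _ ?_)
        · rintro i hi rfl
          rcases hw.eq_and_eq_or_eq_and_eq (he i (by omega)).2 with h' | h'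
          · have := hv (Set.mem_Iic.2 (by omega)) (Set.mem_Iic.2 (by omega)) h'.1
            exact hje (by rw [← this])
          · have := hv (Set.mem_Iic.2 (by omega)) (Set.mem_Iic.2 (by omega)) h'.1
            omega
        · intro k hk
          simp only [Finset.mem_insert, Finset.mem_image, Finset.mem_range] at hk
          rcases hk with rfl | ⟨i, hi, rfl⟩
          · exact hj
          · exact (he i (by omega)).1
      · push Not at hwv
        refine ⟨fun k => Nat.casesOn k w v, fun k => Nat.casesOn k j e, ?_, ?_, ?_⟩
        · rintro (_ | k) hk (_ | l) hl hkl
          · rfl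
          · exact absurd hkl.symm (hwv l (by simpa using hl))
          · exact absurd hkl (hwv k (by simpa using hk))
          · exact congrArg _ (hv (by simpa using hk) (by simpa using hl) hkl)
        · rintro (_ | k) hk
          · exact ⟨hj, hw.symm⟩
          · exact he k (by omega)
        · exact hu
  obtain ⟨v, e, hv, he, -⟩ := path hV.toFinset.card
  have hcard := Finset.card_le_card_of_injOn (s := Finset.range (hV.toFinset.card + 1))
    (t := hV.toFinset) v
    (by
      intro k hk
      have hk' := Finset.mem_range.1 hk
      simpa using (he k hk').2.left_mem)
    (hv.mono (by
      intro k hk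
      have hk' := Finset.mem_range.1 hk
      exact Set.mem_Iic.2 hk'.le))
  simp at hcard

end Graph

/-! ### Edge vectors -/

section EdgeVec

variable {V : Type*} {n : ℕ} {G : Graph V (Fin n)} {K : Type*} [Field K]

/-- The vector `e_a + ε e_b` of an edge that joins `a i` to `b i`. -/
noncomputable def edgeVec (a b : Fin n → V) (ε : K) (i : Fin n) : V →₀ K :=
  Finsupp.single (a i) 1 + ε • Finsupp.single (b i) 1

variable {a b : Fin n → V}

lemma edgeVec_apply_eq_zero (hab : ∀ i, G.IsLink i (a i) (b i)) {ε : K} {i : Fin n} {v : V}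
    (h : ¬ G.Inc i v) : edgeVec a b ε i v = 0 := by
  classical
  have h1 : a i ≠ v := by rintro rfl; exact h (hab i).inc_left
  have h2 : b i ≠ v := by rintro rfl; exact h (hab i).inc_right
  simp [edgeVec, h1, h2]

lemma edgeVec_apply_ne_zero (hab : ∀ i, G.IsLink i (a i) (b i)) {ε : K} (hε : ε ≠ 0)
    {i : Fin n} {v : V} (hi : a i ≠ b i) (h : G.Inc i v) : edgeVec a b ε i v ≠ 0 := by
  classical
  rcases h.eq_or_eq_of_isLink (hab i) with rfl | rfl
  · simp [edgeVec, hi.symm]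
  · simp [edgeVec, hi, hε]

/-- Over every field and for all nonzero choices of `ε`, a combination of the vectors of an acyclic
set of edges that vanishes outside one vertex is trivial. -/
lemma coeff_eq_zero_of_acyclic (hV : G.vertexSet.Finite) (hab : ∀ i, G.IsLink i (a i) (b i))
    {ε : Fin n → K} (hε : ∀ i, ε i ≠ 0) {X : Finset (Fin n)} (hX : ∀ D ⊆ X, ¬ IsCycle G D)
    (c : Fin n → K) (u : V)
    (h : ∀ v, v ≠ u → (∑ i ∈ X, c i • edgeVec a b (ε i) i) v = 0) : ∀ i ∈ X, c i = 0 := by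
  classical
  by_contra! hne
  obtain ⟨i₀, hi₀, hci₀⟩ := hne
  have noloop : ∀ i ∈ X, a i ≠ b i := by
    intro i hi hl
    refine hX {i} (by simpa using hi) (isCycle_singleton_of_isLink (x := a i) ?_)
    have := hab i
    rwa [← hl] at this
  obtain ⟨D, hD, hcyc⟩ := exists_isCycle_subset hV (Y := X.filter (fun i => c i ≠ 0))
    ⟨i₀, by simp [hi₀, hci₀]⟩ (fun i _ => (hab i).edge_mem) u (by
      intro i hi v hiv hvu
      rw [Finset.mem_filter] at hi
      by_contra! hj
      have hv := h v hvu
      rw [Finsupp.finsetSum_apply, Finset.sum_eq_single i] at hv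
      · rw [Finsupp.smul_apply, smul_eq_mul, mul_eq_zero] at hv
        exact hv.elim hi.2 (edgeVec_apply_ne_zero hab (hε i) (noloop i hi.1) hiv)
      · intro j hjX hji
        by_cases hcj : c j = 0
        · simp [hcj]
        · rw [Finsupp.smul_apply, edgeVec_apply_eq_zero hab (hj j (by simp [hjX, hcj]) hji),
            smul_zero]
      · exact fun h => absurd hi.1 h)
  exact hX D (hD.trans (Finset.filter_subset _ _)) hcyc

end EdgeVec

/-! ### Cycles as closed walks -/

section ClosedWalk

variable {V : Type*} {n : ℕ} {G : Graph V (Fin n)}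

open Fin.CommRing in
/-- A cycle, traversed as a closed walk whose last edge is a prescribed one. -/
lemma IsCycle.exists_closedWalk {D : Finset (Fin n)} (hD : IsCycle G D) {f : Fin n} (hf : f ∈ D) :
    ∃ (m : ℕ) (v : ℕ → V) (e : ℕ → Fin n), (∀ k, G.IsLink (e k) (v k) (v (k + 1))) ∧
      v (m + 1) = v 0 ∧ e m = f ∧ Set.InjOn e (Finset.range (m + 1)) ∧
      (Finset.range (m + 1)).image e = D := by
  classical
  obtain ⟨m, v, e, hv, he, hlink, rfl⟩ := hD
  simp only [Finset.mem_image, Finset.mem_univ, true_and] at hf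
  obtain ⟨j, rfl⟩ := hf
  refine ⟨m, fun k => v (j + 1 + (k : Fin (m + 1))), fun k => e (j + 1 + (k : Fin (m + 1))),
    ?_, ?_, ?_, ?_, ?_⟩
  · intro k
    have := hlink (j + 1 + (k : Fin (m + 1)))
    simpa [add_assoc] using this
  · simp
  · have h : ((m : ℕ) : Fin (m + 1)) + 1 = 0 := by
      have := Fin.natCast_self (m + 1)
      rwa [Nat.cast_add, Nat.cast_one] at this
    simp only
    rw [add_assoc, add_comm 1, h, add_zero]
  · intro k hk l hl hkl
    have h := add_left_cancel (he hkl)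
    have h' := congrArg Fin.val h
    rw [Finset.mem_coe, Finset.mem_range] at hk hl
    rwa [Fin.val_natCast, Fin.val_natCast, Nat.mod_eq_of_lt hk, Nat.mod_eq_of_lt hl] at h'
  · ext i
    simp only [Finset.mem_image, Finset.mem_range, Finset.mem_univ, true_and]
    constructor
    · rintro ⟨k, -, rfl⟩
      exact ⟨_, rfl⟩
    · rintro ⟨k, rfl⟩
      refine ⟨(k - (j + 1)).val, (k - (j + 1)).2, ?_⟩
      rw [Fin.cast_val_eq_self, add_sub_cancel]

lemma restrict_adj {X : Set (Fin n)} {i : Fin n} {x y : V} (hi : i ∈ X) (h : G.IsLink i x y) :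
    (G.restrict X).Adj x y :=
  ⟨i, hi, h⟩

lemma mem_componentEdges_iff {X : Finset (Fin n)} {r x y : V} {i : Fin n} (h : G.IsLink i x y) :
    i ∈ componentEdges G X r ↔
      i ∈ X ∧ Relation.ReflTransGen (G.restrict (X : Set (Fin n))).Adj r x := by
  refine and_congr_right fun hi => ⟨?_, fun hr => ⟨x, h.inc_left, hr⟩⟩
  rintro ⟨z, hz, hr⟩
  rcases hz.eq_or_eq_of_isLink h with rfl | rfl
  · exact hr
  · exact hr.tail (restrict_adj hi h.symm)

lemma IsCycle.subset_componentEdges {D X : Finset (Fin n)} (hD : IsCycle G D) (hDX : D ⊆ X)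
    {i : Fin n} (hi : i ∈ D) {r : V} (hr : G.Inc i r) :
    (D : Set (Fin n)) ⊆ componentEdges G X r := by
  classical
  obtain ⟨m, v, e, hlink, hv, rfl, he, rfl⟩ := hD.exists_closedWalk hi
  have hX : ∀ k < m + 1, e k ∈ X := fun k hk =>
    hDX (Finset.mem_image_of_mem _ (Finset.mem_range.2 hk))
  have h0 : Relation.ReflTransGen (G.restrict (X : Set (Fin n))).Adj r (v 0) := by
    rcases hr.eq_or_eq_of_isLink (hlink m) with rfl | rfl
    · rw [← hv]
      exact .single (restrict_adj (hX m (by omega)) (hlink m))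
    · rw [hv]
  have hk : ∀ k < m + 1, Relation.ReflTransGen (G.restrict (X : Set (Fin n))).Adj r (v k) := by
    intro k
    induction k with
    | zero => exact fun _ => h0
    | succ k ih => exact fun h => (ih (by omega)).tail (restrict_adj (hX k (by omega)) (hlink k))
  intro j hj
  simp only [Finset.coe_image, Finset.coe_range, Set.mem_image, Set.mem_Iio] at hj
  obtain ⟨k, hk', rfl⟩ := hj
  exact (mem_componentEdges_iff (hlink k)).2 ⟨hX k hk', hk k hk'⟩

end ClosedWalk

/-! ### The signed-graphic configuration -/

section SignedGraphic

variable {V : Type*} {n : ℕ} {G : Graph V (Fin n)} {a b : Fin n → V}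

/-- The sign of an edge, `-1` for the negative ones. -/
def sgn (s : Bool) : ℚ := if s then -1 else 1

lemma sgn_mul_self (s : Bool) : sgn s * sgn s = 1 := by cases s <;> simp [sgn]

lemma sgn_ne_zero (s : Bool) : sgn s ≠ 0 := by cases s <;> simp [sgn]

/-- The vector `e_a - e_b` of a positive edge and `e_a + e_b` of a negative one. -/
noncomputable def signedVec (a b : Fin n → V) (x : SignedElt n) : V →₀ ℚ :=
  edgeVec a b (-sgn x.starred) x.idx

lemma signedVec_mem_iff (hab : ∀ i, G.IsLink i (a i) (b i)) {U : Submodule ℚ (V →₀ ℚ)}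
    {i : Fin n} {s : Bool} {x y : V} (h : G.IsLink i x y) :
    signedVec a b ⟨i, s⟩ ∈ U ↔ Finsupp.single x 1 - sgn s • Finsupp.single y (1 : ℚ) ∈ U := by
  have e : signedVec a b ⟨i, s⟩ =
      Finsupp.single (a i) 1 - sgn s • Finsupp.single (b i) (1 : ℚ) := by
    simp [signedVec, edgeVec, sub_eq_add_neg]
  rw [e]
  rcases (hab i).eq_and_eq_or_eq_and_eq h with ⟨h1, h2⟩ | ⟨h1, h2⟩
  · rw [h1, h2]
  · rw [h1, h2, ← U.smul_mem_iff (neg_ne_zero.2 (sgn_ne_zero s)), smul_sub, smul_smul, neg_mul,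
      sgn_mul_self, neg_smul, neg_smul, one_smul, sub_neg_eq_add, neg_add_eq_sub]

lemma single_mem_iff_of_signedVec_mem (hab : ∀ i, G.IsLink i (a i) (b i))
    {U : Submodule ℚ (V →₀ ℚ)} {i : Fin n} {s : Bool} {x y : V} (h : G.IsLink i x y)
    (hU : signedVec a b ⟨i, s⟩ ∈ U) :
    Finsupp.single x (1 : ℚ) ∈ U ↔ Finsupp.single y (1 : ℚ) ∈ U := by
  rw [signedVec_mem_iff hab h] at hU
  rw [← U.smul_mem_iff (sgn_ne_zero s) (x := Finsupp.single y (1 : ℚ))]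
  constructor
  · intro hx
    simpa using U.sub_mem hx hU
  · intro hy
    simpa using U.add_mem hU hy

lemma splitsStars_signedVec (hab : ∀ i, G.IsLink i (a i) (b i)) :
    SplitsStars ℚ (signedVec (n := n) a b) := by
  intro U
  have single_mem : ∀ (p : V → Prop) (v : V), p v → Finsupp.single v (1 : ℚ) ∈
      span ℚ ((fun v => Finsupp.single v (1 : ℚ)) '' {v | p v}) :=
    fun p v hv => subset_span ⟨v, hv, rfl⟩
  have vec_mem : ∀ (p : V → Prop) (x : SignedElt n), p (a x.idx) → p (b x.idx) →
      signedVec a b x ∈ span ℚ ((fun v => Finsupp.single v (1 : ℚ)) '' {v | p v}) :=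
    fun p x h1 h2 => add_mem (single_mem p _ h1) (smul_mem _ _ (single_mem p _ h2))
  set q : V → Prop := fun v => Finsupp.single v (1 : ℚ) ∈ U with hq
  have hends : ∀ x, signedVec a b x ∈ U → (q (a x.idx) ↔ q (b x.idx)) := fun x hx =>
    single_mem_iff_of_signedVec_mem hab (hab x.idx) (s := x.starred) hx
  refine ⟨span ℚ ((fun v => Finsupp.single v (1 : ℚ)) '' {v | q v}),
    span ℚ ((fun v => Finsupp.single v (1 : ℚ)) '' {v | ¬ q v}),
    {i | q (a i) ∧ q (b i)}, ?_, ?_, ?_, ?_, ?_⟩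
  · rw [← Finsupp.supported_eq_span_single, ← Finsupp.supported_eq_span_single]
    exact Finsupp.disjoint_supported_supported
      (Set.disjoint_left.2 fun v (h : q v) (h' : ¬ q v) => h' h)
  · rw [span_le]
    rintro _ ⟨v, hv, rfl⟩
    exact hv
  · intro x _ hz
    exact ⟨vec_mem q x hz.1 hz.2, vec_mem q x.star hz.1 hz.2⟩
  · intro x hx hz
    have h := hends x hx
    have h1 : ¬ q (a x.idx) := fun h1 => hz ⟨h1, h.1 h1⟩
    have h2 : ¬ q (b x.idx) := fun h2 => h1 (h.2 h2)
    exact ⟨vec_mem (fun v => ¬ q v) x h1 h2, vec_mem (fun v => ¬ q v) x.star h1 h2⟩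
  · intro x hx hx'
    have h2 : q (a x.idx) := by
      have h := U.add_mem hx hx'
      have e : signedVec a b x + signedVec a b x.star
          = (2 : ℚ) • Finsupp.single (a x.idx) (1 : ℚ) := by
        obtain ⟨i, s⟩ := x
        cases s <;> simp only [signedVec, edgeVec, SignedElt.star, sgn] <;> simp [two_smul] <;> abel
      rw [e] at h
      exact (U.smul_mem_iff two_ne_zero).1 h
    exact ⟨h2, (hends x hx).1 h2⟩

variable {σ : Fin n → Bool}

/-- Along a walk with edge vectors in `U`, the unit vectors of the vertices agree modulo `U` up to
the product of the signs of the edges passed. -/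
lemma single_sub_prod_smul_mem (hab : ∀ i, G.IsLink i (a i) (b i)) {U : Submodule ℚ (V →₀ ℚ)}
    {v : ℕ → V} {e : ℕ → Fin n} (hlink : ∀ k, G.IsLink (e k) (v k) (v (k + 1))) :
    ∀ k, (∀ l < k, signedVec a b ⟨e l, σ (e l)⟩ ∈ U) →
      Finsupp.single (v k) 1 - (∏ l ∈ Finset.range k, sgn (σ (e l))) •
        Finsupp.single (v 0) (1 : ℚ) ∈ U
  | 0, _ => by simp
  | k + 1, h => by
    have ih := single_sub_prod_smul_mem hab hlink k fun l hl => h l (by omega)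
    have h1 := h k (by omega)
    rw [signedVec_mem_iff hab (hlink k).symm] at h1
    have h2 := U.add_mem h1 (U.smul_mem (sgn (σ (e k))) ih)
    rwa [smul_sub, sub_add_sub_cancel, smul_smul, mul_comm, ← Finset.prod_range_succ] at h2

lemma prod_sgn (D : Finset (Fin n)) :
    ∏ i ∈ D, sgn (σ i) = (-1) ^ (D.filter (fun i => σ i = true)).card := by
  simp [sgn, Finset.prod_ite]

/-- The vector of an edge of a balanced cycle is spanned by those of the other edges. -/
lemma IsCycle.signedVec_mem_of_balanced (hab : ∀ i, G.IsLink i (a i) (b i))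
    {U : Submodule ℚ (V →₀ ℚ)} {D : Finset (Fin n)} (hD : IsCycle G D) (hbal : ¬ Unbalanced σ D)
    {f : Fin n} (hf : f ∈ D) (hU : ∀ i ∈ D, i ≠ f → signedVec a b ⟨i, σ i⟩ ∈ U) :
    signedVec a b ⟨f, σ f⟩ ∈ U := by
  classical
  obtain ⟨m, v, e, hlink, hv, rfl, he, rfl⟩ := hD.exists_closedWalk hf
  have h1 := single_sub_prod_smul_mem (σ := σ) hab hlink (U := U) m fun l hl =>
    hU _ (Finset.mem_image_of_mem _ (Finset.mem_range.2 (by omega))) fun h => by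
      have := he (by simp; omega) (by simp) h
      omega
  have h2 : (∏ l ∈ Finset.range m, sgn (σ (e l))) * sgn (σ (e m)) = 1 := by
    rw [← Finset.prod_range_succ, ← Finset.prod_image (f := fun i => sgn (σ i)) he, prod_sgn]
    exact (Nat.not_odd_iff_even.1 hbal).neg_one_pow
  have h3 : ∏ l ∈ Finset.range m, sgn (σ (e l)) = sgn (σ (e m)) := by
    have := congrArg (· * sgn (σ (e m))) h2
    simpa [mul_assoc, sgn_mul_self] using this
  rw [signedVec_mem_iff hab (hlink m), hv, ← h3]
  exact h1

/-- An unbalanced cycle spans the unit vectors of all its vertices. -/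
lemma IsCycle.single_mem_of_unbalanced (hab : ∀ i, G.IsLink i (a i) (b i))
    {U : Submodule ℚ (V →₀ ℚ)} {D : Finset (Fin n)} (hD : IsCycle G D) (hunb : Unbalanced σ D)
    (hU : ∀ i ∈ D, signedVec a b ⟨i, σ i⟩ ∈ U) {i : Fin n} (hi : i ∈ D) {x : V}
    (hx : G.Inc i x) : Finsupp.single x (1 : ℚ) ∈ U := by
  classical
  obtain ⟨m, v, e, hlink, hv, rfl, he, rfl⟩ := hD.exists_closedWalk hi
  have h1 := single_sub_prod_smul_mem (σ := σ) hab hlink (U := U) (m + 1) fun l hl =>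
    hU _ (Finset.mem_image_of_mem _ (Finset.mem_range.2 hl))
  have h2 : ∏ l ∈ Finset.range (m + 1), sgn (σ (e l)) = -1 := by
    rw [← Finset.prod_image (f := fun i => sgn (σ i)) he, prod_sgn]
    exact hunb.neg_one_pow
  rw [h2, hv, neg_smul, one_smul, sub_neg_eq_add, ← two_smul ℚ, U.smul_mem_iff two_ne_zero,
    ← hv] at h1
  rcases hx.eq_or_eq_of_isLink (hlink m) with rfl | rfl
  · exact (single_mem_iff_of_signedVec_mem hab (hlink m) (hU _ hi)).2 h1
  · exact h1

/-- If a subspace contains the vectors of all edges of a cycle except `f`, then it contains the unit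
vectors of both ends of `f` or of neither. -/
lemma IsCycle.single_mem_iff (hab : ∀ i, G.IsLink i (a i) (b i))
    {U : Submodule ℚ (V →₀ ℚ)} {D : Finset (Fin n)} (hD : IsCycle G D) {f : Fin n} (hf : f ∈ D)
    (hU : ∀ i ∈ D, i ≠ f → signedVec a b ⟨i, σ i⟩ ∈ U) {x y : V} (h : G.IsLink f x y) :
    Finsupp.single x (1 : ℚ) ∈ U ↔ Finsupp.single y (1 : ℚ) ∈ U := by
  classical
  obtain ⟨m, v, e, hlink, hv, rfl, he, rfl⟩ := hD.exists_closedWalk hf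
  have key : ∀ k ≤ m, (Finsupp.single (v 0) (1 : ℚ) ∈ U ↔ Finsupp.single (v k) (1 : ℚ) ∈ U) := by
    intro k
    induction k with
    | zero => exact fun _ => Iff.rfl
    | succ k ih =>
      intro hk
      rw [ih (by omega)]
      refine single_mem_iff_of_signedVec_mem hab (hlink k)
        (hU _ (Finset.mem_image_of_mem _ (Finset.mem_range.2 (by omega))) fun h => ?_)
      have := he (by simp; omega) (by simp) h
      omega
  rw [← hv] at key
  rcases h.eq_and_eq_or_eq_and_eq (hlink m) with ⟨rfl, rfl⟩ | ⟨rfl, rfl⟩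
  · exact (key m le_rfl).symm
  · exact key m le_rfl

/-- The support of a linear relation contains a cycle, which is unbalanced and the only one in its
component. An edge `f` of it is spanned by the rest of the component; then so is the unit vector of
an end of `f`, although the rest of the component is a tree. -/
lemma linearIndepOn_of_signedGraphicIndep (hV : G.vertexSet.Finite)
    (hab : ∀ i, G.IsLink i (a i) (b i)) {X : Finset (Fin n)} (hX : SignedGraphicIndep G σ X) :
    LinearIndepOn ℚ (fun i => signedVec a b ⟨i, σ i⟩) (X : Set (Fin n)) := by
  classical
  by_contra hdep
  obtain ⟨c, hc, i₀, hi₀, hci₀⟩ := not_linearIndepOn_finset_iff.1 hdep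
  have hε : ∀ i, -sgn (σ i) ≠ 0 := fun i => neg_ne_zero.2 (sgn_ne_zero _)
  -- the support of the relation contains a cycle
  obtain ⟨D, hDY, hD⟩ : ∃ D ⊆ X.filter (fun i => c i ≠ 0), IsCycle G D := by
    by_contra! hacyc
    refine hci₀ (coeff_eq_zero_of_acyclic hV hab hε hacyc c (a i₀) ?_ i₀ (by simp [hi₀, hci₀]))
    intro v _
    have : ∑ i ∈ X.filter (fun i => c i ≠ 0), c i • edgeVec a b (-sgn (σ i)) i = 0 := by
      rw [← hc, Finset.sum_filter]
      refine Finset.sum_congr rfl fun i _ => ?_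
      split_ifs with h
      · rfl
      · rw [not_not.1 h, zero_smul]
    rw [this, Finsupp.zero_apply]
  obtain ⟨f, hf⟩ := hD.nonempty
  have hDX : D ⊆ X := hDY.trans (Finset.filter_subset _ _)
  set r := a f with hr
  have hfr : G.Inc f r := (hab f).inc_left
  have hDr := hD.subset_componentEdges hDX hf hfr
  rcases hX r hfr.vertex_mem with hno | ⟨D₀, -, huniq, hunb⟩
  · exact hno D hD hDr
  obtain rfl := huniq D hD hDr
  -- the relation restricts to the component of the cycle
  set X' := X.filter (· ∈ componentEdges G X r) with hX'
  have hfX' : f ∈ X' := Finset.mem_filter.2 ⟨hDX hf, hDr hf⟩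
  have hrel : ∑ i ∈ X', c i • signedVec a b ⟨i, σ i⟩ = 0 := by
    ext v
    rw [Finsupp.finsetSum_apply, Finsupp.zero_apply]
    by_cases hv : Relation.ReflTransGen (G.restrict (X : Set (Fin n))).Adj r v
    · have h0 := DFunLike.congr_fun hc v
      rw [Finsupp.finsetSum_apply, Finsupp.zero_apply] at h0
      rw [← h0]
      refine Finset.sum_subset (Finset.filter_subset _ _) fun i hi hi' => ?_
      rw [Finsupp.smul_apply, signedVec, edgeVec_apply_eq_zero hab, smul_zero]
      exact fun hinc => hi' (Finset.mem_filter.2 ⟨hi, hi, v, hinc, hv⟩)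
    · refine Finset.sum_eq_zero fun i hi => ?_
      rw [Finsupp.smul_apply, signedVec, edgeVec_apply_eq_zero hab, smul_zero]
      rintro ⟨w, hw⟩
      exact hv ((mem_componentEdges_iff hw).1 (Finset.mem_filter.1 hi).2).2
  set U := span ℚ ((fun i => signedVec a b ⟨i, σ i⟩) '' (X'.erase f : Finset (Fin n))) with hU
  have hsub : ∀ i ∈ X', i ≠ f → signedVec a b ⟨i, σ i⟩ ∈ U := fun i hi hif =>
    subset_span ⟨i, Finset.mem_coe.2 (Finset.mem_erase.2 ⟨hif, hi⟩), rfl⟩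
  have hfU : signedVec a b ⟨f, σ f⟩ ∈ U := by
    rw [← Finset.add_sum_erase _ _ hfX'] at hrel
    have hcf : c f ≠ 0 := (Finset.mem_filter.1 (hDY hf)).2
    rw [← U.smul_mem_iff hcf, eq_neg_of_add_eq_zero_left hrel]
    exact U.neg_mem (U.sum_mem fun i hi => U.smul_mem _
      (hsub i (Finset.mem_of_mem_erase hi) (Finset.ne_of_mem_erase hi)))
  have hrU : Finsupp.single r (1 : ℚ) ∈ U := by
    refine hD.single_mem_of_unbalanced hab hunb (fun i hi => ?_) hf hfr
    by_cases hif : i = f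
    · rw [hif]; exact hfU
    · exact hsub i (Finset.mem_filter.2 ⟨hDX hi, hDr hi⟩) hif
  obtain ⟨d, hd⟩ := (mem_span_image_finset_iff_exists_fun' ℚ).1 hrU
  -- without `f` the component is acyclic, so it cannot span a unit vector
  have hd0 := coeff_eq_zero_of_acyclic hV hab hε (X := X'.erase f) (fun D' hD' hcyc => by
      have : D' = D := huniq D' hcyc fun i hi =>
        (Finset.mem_filter.1 (Finset.mem_of_mem_erase (hD' hi))).2
      exact Finset.notMem_erase f X' (hD' (this ▸ hf))) d r (fun v hv => by
      change (∑ i ∈ X'.erase f, d i • signedVec a b ⟨i, σ i⟩) v = 0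
      rw [hd, Finsupp.single_eq_of_ne hv])
  rw [Finset.sum_eq_zero fun i hi => by rw [hd0 i hi, zero_smul]] at hd
  have := DFunLike.congr_fun hd r
  simp at this

/-- A balanced cycle is dependent. If a component contains an unbalanced cycle that avoids an edge
`f` of another cycle, then the edges other than `f` span the unit vectors of all vertices of the
component, and hence the vector of `f`. -/
lemma signedGraphicIndep_of_linearIndepOn (hab : ∀ i, G.IsLink i (a i) (b i))
    {X : Finset (Fin n)}
    (hX : LinearIndepOn ℚ (fun i => signedVec a b ⟨i, σ i⟩) (X : Set (Fin n))) :
    SignedGraphicIndep G σ X := by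
  classical
  have hcX : ∀ {D : Finset (Fin n)} {r : V}, (D : Set (Fin n)) ⊆ componentEdges G X r →
      D ⊆ X := fun h i hi => (h hi).1
  have hmem : ∀ {f i : Fin n}, i ∈ X → i ≠ f → signedVec a b ⟨i, σ i⟩ ∈
      span ℚ ((fun i => signedVec a b ⟨i, σ i⟩) '' ((X : Set (Fin n)) \ {f})) :=
    fun hi hif => subset_span ⟨_, ⟨hi, hif⟩, rfl⟩
  have hunb : ∀ D, IsCycle G D → D ⊆ X → Unbalanced σ D := by
    intro D hD hDX
    by_contra hbal
    obtain ⟨f, hf⟩ := hD.nonempty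
    exact hX.notMem_span (hDX hf)
      (hD.signedVec_mem_of_balanced hab hbal hf fun i hi hif => hmem (hDX hi) hif)
  -- two cycles in one component: an edge `f` of only one of them is spanned by the others
  have hle : ∀ r D D', IsCycle G D → IsCycle G D' →
      (D : Set (Fin n)) ⊆ componentEdges G X r → (D' : Set (Fin n)) ⊆ componentEdges G X r →
      D ⊆ D' := by
    intro r D D' hD hD' hDr hDr' f hf
    by_contra hfD'
    set U := span ℚ ((fun i => signedVec a b ⟨i, σ i⟩) '' ((X : Set (Fin n)) \ {f})) with hU
    have hfX := hcX hDr hf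
    have hstep : ∀ i ∈ X, ∀ x y, G.IsLink i x y →
        (Finsupp.single x (1 : ℚ) ∈ U ↔ Finsupp.single y (1 : ℚ) ∈ U) := by
      intro i hi x y hxy
      by_cases hif : i = f
      · subst hif
        exact hD.single_mem_iff (σ := σ) hab hf (fun j hj hji => hmem (hcX hDr hj) hji) hxy
      · exact single_mem_iff_of_signedVec_mem hab hxy (hmem hi hif)
    have hreach : ∀ {s : V}, Relation.ReflTransGen (G.restrict (X : Set (Fin n))).Adj r s →
        (Finsupp.single r (1 : ℚ) ∈ U ↔ Finsupp.single s (1 : ℚ) ∈ U) := by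
      intro s hs
      induction hs with
      | refl => rfl
      | tail _ h ih =>
        obtain ⟨i, hi, hl⟩ := h
        rw [ih, hstep i hi _ _ hl]
    have hrU : Finsupp.single r (1 : ℚ) ∈ U := by
      obtain ⟨g, hg⟩ := hD'.nonempty
      obtain ⟨-, x, hgx, hx⟩ := hDr' hg
      refine (hreach hx).2 (hD'.single_mem_of_unbalanced hab (hunb D' hD' (hcX hDr'))
        (fun i hi => hmem (hcX hDr' hi) ?_) hg hgx)
      rintro rfl
      exact hfD' hi
    have ha := ((mem_componentEdges_iff (hab f)).1 (hDr hf)).2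
    have hb := ((mem_componentEdges_iff (hab f).symm).1 (hDr hf)).2
    refine hX.notMem_span hfX (?_ : signedVec a b ⟨f, σ f⟩ ∈ U)
    rw [signedVec_mem_iff hab (hab f)]
    exact U.sub_mem ((hreach ha).1 hrU) (U.smul_mem _ ((hreach hb).1 hrU))
  intro r _
  by_cases h : ∃ D, IsCycle G D ∧ (D : Set (Fin n)) ⊆ componentEdges G X r
  · obtain ⟨D, hD, hDr⟩ := h
    exact Or.inr ⟨D, ⟨hD, hDr⟩, fun D' hD' hDr' =>
      (hle r D' D hD' hD hDr' hDr).antisymm (hle r D D' hD hD' hDr hDr'), hunb D hD (hcX hDr)⟩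
  · push Not at h
    exact Or.inl h

lemma linearIndepOn_image_iff {ι κ K W : Type*} [Field K] [AddCommGroup W] [Module K W]
    [DecidableEq κ] {φ : κ → W} {f : ι → κ} (hf : Function.Injective f) {X : Finset ι} :
    LinearIndepOn K φ ((X.image f : Finset κ) : Set κ) ↔
      LinearIndepOn K (fun i => φ (f i)) (X : Set ι) := by
  rw [Finset.coe_image]
  exact ⟨fun h => h.comp_of_image hf.injOn, fun h => h.image_of_comp f φ⟩

lemma admissible_image (σ : Fin n → Bool) (X : Finset (Fin n)) :
    Admissible (X.image fun i => (⟨i, σ i⟩ : SignedElt n)) := by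
  rw [admissible_iff]
  intro x hx hx'
  simp only [Finset.mem_image] at hx hx'
  obtain ⟨i, -, rfl⟩ := hx
  obtain ⟨j, -, h⟩ := hx'
  simp only [SignedElt.star, SignedElt.mk.injEq] at h
  obtain ⟨rfl, h⟩ := h
  simp at h

/-- An admissible set is the signing of its underlying set of edges in which the edges of
`negEdges` are negative. -/
lemma Admissible.image_underlyingEdges {S : Finset (SignedElt n)} (hS : Admissible S) :
    (underlyingEdges S).image (fun i => (⟨i, decide (⟨i, true⟩ ∈ S)⟩ : SignedElt n)) = S := by
  have h : ∀ x ∈ S, (⟨x.idx, decide (⟨x.idx, true⟩ ∈ S)⟩ : SignedElt n) = x := by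
    rintro ⟨i, s⟩ hx
    have := admissible_iff.1 hS _ hx
    cases s <;> simp_all [SignedElt.star]
  rw [underlyingEdges, Finset.image_image]
  exact (Finset.image_congr fun x hx => h x hx).trans Finset.image_id

lemma signedGraphicIndep_iff (hV : G.vertexSet.Finite) (hab : ∀ i, G.IsLink i (a i) (b i))
    {X : Finset (Fin n)} : SignedGraphicIndep G σ X ↔
      LinearIndepOn ℚ (signedVec a b)
        ((X.image (fun i => (⟨i, σ i⟩ : SignedElt n)) : Finset (SignedElt n)) :
          Set (SignedElt n)) := by
  rw [linearIndepOn_image_iff fun i j h => congrArg SignedElt.idx h]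
  exact ⟨linearIndepOn_of_signedGraphicIndep hV hab, signedGraphicIndep_of_linearIndepOn hab⟩

lemma signedGraphicCircuits_eq (hV : G.vertexSet.Finite) (hab : ∀ i, G.IsLink i (a i) (b i)) :
    signedGraphicCircuits G = admCircuits ℚ (signedVec (n := n) a b) := by
  have hinj : ∀ σ : Fin n → Bool, Function.Injective fun i => (⟨i, σ i⟩ : SignedElt n) :=
    fun σ i j h => congrArg SignedElt.idx h
  have key : ∀ (σ : Fin n → Bool) (X : Finset (Fin n)),
      Minimal (fun Y => ¬ SignedGraphicIndep G σ Y) X ↔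
        X.image (fun i => (⟨i, σ i⟩ : SignedElt n)) ∈ admCircuits ℚ (signedVec (n := n) a b) := by
    intro σ X
    simp only [signedGraphicIndep_iff hV hab]
    constructor
    · rintro ⟨h, hmin⟩
      refine ⟨⟨admissible_image σ X, h⟩, fun S hS hSX => ?_⟩
      obtain ⟨Y, hY, rfl⟩ := Finset.subset_image_iff.1 hSX
      exact Finset.image_subset_image (hmin hS.2 hY)
    · rintro ⟨⟨-, h⟩, hmin⟩
      refine ⟨h, fun Y hY hYX => ?_⟩
      exact (Finset.image_subset_image_iff (hinj σ)).1
        (hmin ⟨admissible_image σ Y, hY⟩ (Finset.image_subset_image hYX))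
  ext S
  constructor
  · rintro ⟨σ, X, hX, rfl⟩
    exact (key σ X).1 hX
  · intro hS
    refine ⟨fun i => decide (⟨i, true⟩ ∈ S), underlyingEdges S, ?_,
      hS.1.1.image_underlyingEdges.symm⟩
    rw [key, hS.1.1.image_underlyingEdges]
    exact hS

end SignedGraphic

/-! ### The even-cycle configuration -/

section EvenCycle

variable {V : Type*} {n : ℕ} {G : Graph V (Fin n)} {a b : Fin n → V}

/-- Over the field with two elements, the incidence vector of an edge together with the parity of
its sign. -/
noncomputable def parityVec (a b : Fin n → V) (x : SignedElt n) : (V →₀ ZMod 2) × ZMod 2 :=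
  (edgeVec a b 1 x.idx, if x.starred then 1 else 0)

lemma parityVec_star (x : SignedElt n) : parityVec a b x.star = parityVec a b x + (0, 1) := by
  obtain ⟨i, s⟩ := x
  cases s
  · simp [parityVec, SignedElt.star]
  · simp only [parityVec, SignedElt.star]
    ext1
    · simp
    · simpa using (CharTwo.add_self_eq_zero (1 : ZMod 2)).symm

/-- The two vectors of an edge differ by `(0, 1)`, so they belong to a subspace together or not at
all if it contains `(0, 1)`, and never both belong to it otherwise. -/
lemma splitsStars_parityVec : SplitsStars (ZMod 2) (parityVec (n := n) a b) := by
  intro U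
  by_cases h : ((0, 1) : (V →₀ ZMod 2) × ZMod 2) ∈ U
  · refine ⟨U, ⊥, Set.univ, disjoint_bot_right, le_rfl, fun x hx _ => ⟨hx, ?_⟩,
      fun x _ hx => absurd (Set.mem_univ _) hx, fun x _ _ => Set.mem_univ _⟩
    rw [parityVec_star]
    exact U.add_mem hx h
  · refine ⟨⊥, ⊤, ∅, disjoint_bot_left, bot_le, fun x _ hx => absurd hx (Set.notMem_empty _),
      fun x _ _ => ⟨mem_top, mem_top⟩, fun x hx hx' => absurd ?_ h⟩
    rw [parityVec_star] at hx'
    simpa using U.sub_mem hx' hx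

lemma edgeVec_one_eq (hab : ∀ i, G.IsLink i (a i) (b i)) {i : Fin n} {x y : V}
    (h : G.IsLink i x y) :
    edgeVec a b (1 : ZMod 2) i = Finsupp.single x 1 + Finsupp.single y 1 := by
  rw [edgeVec, one_smul]
  rcases (hab i).eq_and_eq_or_eq_and_eq h with ⟨h1, h2⟩ | ⟨h1, h2⟩
  · rw [h1, h2]
  · rw [h1, h2, add_comm]

lemma IsCycle.sum_edgeVec_eq_zero (hab : ∀ i, G.IsLink i (a i) (b i)) {D : Finset (Fin n)}
    (hD : IsCycle G D) : ∑ i ∈ D, edgeVec a b (1 : ZMod 2) i = 0 := by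
  classical
  have hself : ∀ w : V →₀ ZMod 2, w + w = 0 := fun w => by
    rw [← two_smul (ZMod 2), show (2 : ZMod 2) = 0 from rfl, zero_smul]
  obtain ⟨f, hf⟩ := hD.nonempty
  obtain ⟨m, v, e, hlink, hv, -, he, rfl⟩ := hD.exists_closedWalk hf
  rw [Finset.sum_image he]
  have key : ∀ k, ∑ l ∈ Finset.range k, edgeVec a b (1 : ZMod 2) (e l) =
      Finsupp.single (v 0) 1 + Finsupp.single (v k) 1 := by
    intro k
    induction k with
    | zero => simp [hself]
    | succ k ih =>
      rw [Finset.sum_range_succ, ih, edgeVec_one_eq hab (hlink k), add_assoc,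
        ← add_assoc (Finsupp.single (v k) 1), hself, zero_add]
  rw [key, hv, hself]

/-- A set of edges that meets every vertex evenly is a union of cycles. -/
lemma exists_biUnion_isCycle_eq (hV : G.vertexSet.Finite) (hab : ∀ i, G.IsLink i (a i) (b i))
    (Y : Finset (Fin n)) (hY : ∑ i ∈ Y, edgeVec a b (1 : ZMod 2) i = 0) :
    ∃ 𝒟 : Finset (Finset (Fin n)), 𝒟.biUnion id = Y ∧ ∀ D ∈ 𝒟, IsCycle G D := by
  classical
  induction Y using Finset.strongInduction with
  | H Y ih =>
    rcases Y.eq_empty_or_nonempty with rfl | ⟨i, hi⟩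
    · exact ⟨∅, by simp, by simp⟩
    obtain ⟨D, hDY, hD⟩ : ∃ D ⊆ Y, IsCycle G D := by
      by_contra! hacyc
      refine one_ne_zero (coeff_eq_zero_of_acyclic hV hab (K := ZMod 2) (ε := fun _ => 1)
        (fun _ => one_ne_zero) hacyc (fun _ => 1) (a i) (fun v _ => ?_) i hi)
      simp only [one_smul, hY, Finsupp.zero_apply]
    have hsum := Finset.sum_sdiff (f := edgeVec a b (1 : ZMod 2)) hDY
    rw [hD.sum_edgeVec_eq_zero hab, add_zero, hY] at hsum
    obtain ⟨𝒟, h𝒟, hcyc⟩ := ih (Y \ D)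
      (Finset.sdiff_ssubset hDY hD.nonempty) hsum
    refine ⟨insert D 𝒟, ?_, ?_⟩
    · rw [Finset.biUnion_insert, h𝒟, id, Finset.union_sdiff_of_subset hDY]
    · intro D' hD'
      rw [Finset.mem_insert] at hD'
      rcases hD' with rfl | hD'
      · exact hD
      · exact hcyc D' hD'

lemma mem_underlyingEdges {S : Finset (SignedElt n)} {i : Fin n} :
    i ∈ underlyingEdges S ↔ ∃ x ∈ S, x.idx = i := by
  simp [underlyingEdges]

lemma negEdges_eq_image (S : Finset (SignedElt n)) :
    negEdges S = (S.filter (fun x => x.starred = true)).image SignedElt.idx := by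
  ext i
  simp only [negEdges, Finset.mem_filter, Finset.mem_univ, true_and, Finset.mem_image]
  constructor
  · exact fun h => ⟨_, ⟨h, rfl⟩, rfl⟩
  · rintro ⟨⟨i, s⟩, ⟨h, rfl⟩, rfl⟩
    exact h

lemma negEdges_subset (S : Finset (SignedElt n)) : negEdges S ⊆ underlyingEdges S := by
  rw [negEdges_eq_image]
  exact Finset.image_subset_image (Finset.filter_subset _ _)

lemma underlyingEdges_filter {S : Finset (SignedElt n)} {D : Finset (Fin n)}
    (hD : D ⊆ underlyingEdges S) : underlyingEdges (S.filter (fun x => x.idx ∈ D)) = D := by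
  ext i
  simp only [mem_underlyingEdges, Finset.mem_filter]
  constructor
  · rintro ⟨x, ⟨-, hx⟩, rfl⟩
    exact hx
  · intro hi
    obtain ⟨x, hx, rfl⟩ := mem_underlyingEdges.1 (hD hi)
    exact ⟨x, ⟨hx, hi⟩, rfl⟩

lemma negEdges_filter {S : Finset (SignedElt n)} {D : Finset (Fin n)} :
    negEdges (S.filter (fun x => x.idx ∈ D)) = D ∩ negEdges S := by
  ext i
  simp [negEdges, and_comm]

lemma Admissible.sum_parityVec {S : Finset (SignedElt n)} (hS : Admissible S) :
    ∑ x ∈ S, parityVec a b x =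
      (∑ i ∈ underlyingEdges S, edgeVec a b 1 i, ((negEdges S).card : ZMod 2)) := by
  refine Prod.ext ?_ ?_
  · rw [Prod.fst_sum, underlyingEdges, Finset.sum_image hS.injOn_idx]
    rfl
  · rw [Prod.snd_sum, negEdges_eq_image, Finset.card_image_of_injOn
      (hS.injOn_idx.mono (by exact_mod_cast Finset.filter_subset _ _))]
    simp [parityVec, Finset.sum_boole]

/-- An even set of edges with an even number of negative ones is a union of cycles. Either one of
these is balanced, or all are unbalanced; in both cases a member of `cycleFamily G` results. -/
lemma exists_mem_cycleFamily_subset (hV : G.vertexSet.Finite)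
    (hab : ∀ i, G.IsLink i (a i) (b i)) {S : Finset (SignedElt n)} (hS : Admissible S)
    (hdep : ¬ LinearIndepOn (ZMod 2) (parityVec a b) (S : Set (SignedElt n))) :
    ∃ T ∈ cycleFamily G, T ⊆ S := by
  classical
  obtain ⟨c, hc, x₀, hx₀, hcx₀⟩ := not_linearIndepOn_finset_iff.1 hdep
  set Y := S.filter (fun x => c x ≠ 0) with hYdef
  have hYS : Y ⊆ S := Finset.filter_subset _ _
  have hYadm : Admissible Y := hS.subset hYS
  have hsum : ∑ x ∈ Y, parityVec a b x = 0 := by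
    rw [← hc, hYdef, Finset.sum_filter]
    refine Finset.sum_congr rfl fun x _ => ?_
    split_ifs with h
    · have : c x = 1 := (by decide : ∀ z : ZMod 2, z ≠ 0 → z = 1) _ h
      rw [this, one_smul]
    · rw [not_not.1 h, zero_smul]
  rw [hYadm.sum_parityVec, Prod.mk_eq_zero, ZMod.natCast_eq_zero_iff_even] at hsum
  obtain ⟨𝒟, h𝒟, hcyc⟩ := exists_biUnion_isCycle_eq hV hab _ hsum.1
  have hx₀Y : x₀.idx ∈ underlyingEdges Y :=
    mem_underlyingEdges.2 ⟨x₀, Finset.mem_filter.2 ⟨hx₀, hcx₀⟩, rfl⟩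
  by_cases hodd : ∀ D ∈ 𝒟, Odd (D ∩ negEdges Y).card
  · refine ⟨Y, ⟨hYadm, Or.inr ⟨⟨𝒟, ?_, h𝒟, fun D hD => ⟨hcyc D hD, hodd D hD⟩⟩, hsum.2⟩⟩, hYS⟩
    rw [← h𝒟, Finset.mem_biUnion] at hx₀Y
    obtain ⟨D, hD, -⟩ := hx₀Y
    exact ⟨D, hD⟩
  · push Not at hodd
    obtain ⟨D, hD, hev⟩ := hodd
    have hDY : D ⊆ underlyingEdges Y := h𝒟 ▸ Finset.subset_biUnion_of_mem id hD
    refine ⟨Y.filter (fun x => x.idx ∈ D), ⟨hYadm.subset (Finset.filter_subset _ _), Or.inl ?_⟩,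
      (Finset.filter_subset _ _).trans hYS⟩
    rw [underlyingEdges_filter hDY, negEdges_filter]
    exact ⟨hcyc D hD, Nat.not_odd_iff_even.1 hev⟩

/-- A balanced cycle sums to zero; two different unbalanced cycles have the same sum `(0, 1)`. -/
lemma not_linearIndepOn_of_mem_cycleFamily (hab : ∀ i, G.IsLink i (a i) (b i))
    {S : Finset (SignedElt n)} (hS : S ∈ cycleFamily G) :
    ¬ LinearIndepOn (ZMod 2) (parityVec a b) (S : Set (SignedElt n)) := by
  classical
  intro hI
  rw [linearIndepOn_finset_iff] at hI
  obtain ⟨hadm, ⟨hcyc, hev⟩ | ⟨⟨𝒟, ⟨D₁, hD₁⟩, h𝒟, hcyc⟩, hev⟩⟩ := hS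
  · have h0 := hI (fun _ => 1) (by
      simp only [one_smul]
      rw [hadm.sum_parityVec, hcyc.sum_edgeVec_eq_zero hab,
        (ZMod.natCast_eq_zero_iff_even).2 hev]
      rfl)
    obtain ⟨i, hi⟩ := hcyc.nonempty
    obtain ⟨x, hx, -⟩ := mem_underlyingEdges.1 hi
    exact one_ne_zero (h0 x hx)
  · have hsub : ∀ D ∈ 𝒟, D ⊆ underlyingEdges S := fun D hD =>
      h𝒟 ▸ Finset.subset_biUnion_of_mem id hD
    have hsum : ∀ D ∈ 𝒟, ∑ x ∈ S.filter (fun x => x.idx ∈ D), parityVec a b x = (0, 1) := by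
      intro D hD
      rw [(hadm.subset (Finset.filter_subset _ _)).sum_parityVec,
        underlyingEdges_filter (hsub D hD),
        negEdges_filter, (hcyc D hD).1.sum_edgeVec_eq_zero hab,
        (ZMod.natCast_eq_one_iff_odd).2 (hcyc D hD).2]
    have huniq : ∀ D ∈ 𝒟, D = D₁ := by
      intro D hD
      have h0 := hI (fun x => (if x.idx ∈ D then 1 else 0) - (if x.idx ∈ D₁ then 1 else 0)) (by
        simp only [sub_smul, Finset.sum_sub_distrib, ite_smul, one_smul, zero_smul,
          ← Finset.sum_filter]
        rw [hsum D hD, hsum D₁ hD₁, sub_self])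
      have hiff : ∀ x ∈ S, (x.idx ∈ D ↔ x.idx ∈ D₁) := by
        intro x hx
        have := h0 x hx
        by_cases h1 : x.idx ∈ D <;> by_cases h2 : x.idx ∈ D₁ <;> simp_all
      rw [← underlyingEdges_filter (hsub D hD), ← underlyingEdges_filter (hsub D₁ hD₁),
        Finset.filter_congr hiff]
    have hD₁S : D₁ = underlyingEdges S := by
      refine (hsub D₁ hD₁).antisymm ?_
      rw [← h𝒟]
      exact Finset.biUnion_subset.2 fun D hD => (huniq D hD).le
    have hodd := (hcyc D₁ hD₁).2
    rw [hD₁S, Finset.inter_eq_right.2 (negEdges_subset S)] at hodd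
    exact Nat.not_odd_iff_even.2 hev hodd

/-- Every member of `cycleFamily G` is dependent and every dependent admissible set contains a
member, so the minimal members are the minimal dependent sets. -/
lemma minimalCycleFamily_eq (hV : G.vertexSet.Finite) (hab : ∀ i, G.IsLink i (a i) (b i)) :
    minimalCycleFamily G = admCircuits (ZMod 2) (parityVec (n := n) a b) := by
  ext C
  constructor
  · rintro ⟨hC, hmin⟩
    refine ⟨⟨hC.1, not_linearIndepOn_of_mem_cycleFamily hab hC⟩, fun S hS hSC => ?_⟩
    obtain ⟨T, hT, hTS⟩ := exists_mem_cycleFamily_subset hV hab hS.1 hS.2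
    exact (hmin hT (hTS.trans hSC)).trans hTS
  · rintro ⟨hC, hmin⟩
    obtain ⟨T, hT, hTC⟩ := exists_mem_cycleFamily_subset hV hab hC.1 hC.2
    have hCT := hmin ⟨hT.1, not_linearIndepOn_of_mem_cycleFamily hab hT⟩ hTC
    obtain rfl : T = C := le_antisymm hTC hCT
    exact ⟨hT, fun S hS hSC => hmin ⟨hS.1, not_linearIndepOn_of_mem_cycleFamily hab hS⟩ hSC⟩

end EvenCycle

end SymplecticMatroid

theorem mainTheorem2 {V : Type*} {n : ℕ} (G : Graph V (Fin n))
    (hV : G.vertexSet.Finite) (hE : G.edgeSet = Set.univ) :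
    (SymplecticMatroid.CircuitAxioms (SymplecticMatroid.signedGraphicCircuits G) ∧
      SymplecticMatroid.IsCircuits (SymplecticMatroid.signedGraphicCircuits G)) ∧
    (SymplecticMatroid.CircuitAxioms (SymplecticMatroid.minimalCycleFamily G) ∧
      SymplecticMatroid.IsCircuits (SymplecticMatroid.minimalCycleFamily G)) := by
  have hends : ∀ i, ∃ x y, G.IsLink i x y := fun i =>
    G.exists_isLink_of_mem_edgeSet (hE ▸ Set.mem_univ i)
  choose a b hab using hends
  rw [SymplecticMatroid.signedGraphicCircuits_eq hV hab,
    SymplecticMatroid.minimalCycleFamily_eq hV hab]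
  exact ⟨SymplecticMatroid.circuitAxioms_and_isCircuits
      (SymplecticMatroid.splitsStars_signedVec hab),
    SymplecticMatroid.circuitAxioms_and_isCircuits SymplecticMatroid.splitsStars_parityVec⟩
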